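/- Let $R$ be a complete discrete valuation ring with quotient field $K$, let $F$ be a finite-dimensional skew field over $K$, let $O$ be the maximal $R$-order in $F$, $I=\operatorname{rad}(O)$ its Jacobson radical, $\bar O=O/I$, and choose $w\in I$ with $I=wO=Ow$. For a ring $\Gamma$ let $\operatorname{Aut}(\Gamma)$ be its group of ring automorphisms and write $\mathsf{Ad}_a(x)=axa^{-1}$. Let $r\ge 1$, let $\vec p=(p_1,\dots,p_r)$ be a vector of positive integers, $p=p_1+\dots+p_r$, and let $H=H(O,\vec p)\subset M_p(F)$ be the ring of all block matrices $(x_{ij})_{1\le i,j\le r}$, with $x_{ij}$ of size $p_i\times p_j$, such that $x_{ij}$ has entries in $O$ for $i\ge j$ and in $I$ for $i<j$. Let $1\le t\le r$ be minimal such that $\vec p=(p_1,\dots,p_t;\,p_1,\dots,p_t;\,\dots;\,p_1,\dots,p_t)$, put $q=p_1+\dots+p_t$, and let $$\varrho=\begin{pmatrix}0&0&\cdots&0&w\mathbb 1_q\\ \mathbb 1_q&0&\cdots&0&0\\ 0&\mathbb 1_q&\cdots&0&0\\ \vdots&\vdots&\ddots&\vdots&\vdots\\ 0&0&\cdots&\mathbb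 1_q&0\end{pmatrix}\in M_p(F)$$ (so $\varrho=w\mathbb 1_p$ if $t=r$). Then $w$ is invertible in $F$ and $\mathsf{Ad}_w(O)=O$; $\varrho$ is invertible in $M_p(F)$ and $\mathsf{Ad}_\varrho(H)=H$; and reduction of the diagonal blocks modulo $I$ induces an isomorphism $\bar H:=H/\operatorname{rad}(H)\cong M_{p_1}(\bar O)\times\dots\times M_{p_r}(\bar O)$. The group $\operatorname{Aut}(H)$ is generated by (a) all inner automorphisms of $H$; (b) the automorphisms of $H$ obtained by applying an automorphism of the ring $O$ to all matrix entries; (c) the automorphism $\mathsf{Ad}_\varrho$. The automorphisms of $\bar H\cong M_{p_1}(\bar O)\times\dots\times M_{p_r}(\bar O)$ which they induce are the following: (a) the inner automorphisms of $H$ induce precisely all inner automorphisms of $\bar H$; (b) the automorphism given by $\psi\in\operatorname{Aut}(O)$ induces the entrywise action of its image $\bar\psi\in\operatorname{Aut}(\bar O)$; thus one obtains precisely the entrywise actions of those automorphisms of $\bar O$ that lie in the image of the canonical homomorphism $\operatorname{Aut}(O)\to\operatorname{Aut}(\bar O)$; (c) $\mathsf{Ad}_\varrho$ induces the twisted cyclic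 shift $$(z_1,\dots,z_r)\mapsto\bigl(\kappa(z_{r-t+1}),\dots,\kappa(z_r),z_1,\dots,z_{r-t}\bigr),$$ where $\kappa\in\operatorname{Aut}(\bar O)$ is induced by $\mathsf{Ad}_w\in\operatorname{Aut}(O)$ and is applied to all matrix entries. Finally, if $\widetilde w\in I$ is another element with $I=\widetilde wO=O\widetilde w$, then $\widetilde w=uw$ for some $u\in O^\ast$, and the twisted cyclic shift defined by $\widetilde w$ is the composition of the one defined by $w$ with an inner automorphism of $M_{p_1}(\bar O)\times\dots\times M_{p_r}(\bar O)$. -/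

import Mathlib

namespace HereditaryOrder

section General

/-- The inner automorphism `x ↦ a x a⁻¹` of a ring. -/
def Ad {Γ : Type*} [Ring Γ] (a : Γˣ) : RingAut Γ where
  toFun x := a * x * (a⁻¹ : Γˣ)
  invFun x := (a⁻¹ : Γˣ) * x * a
  left_inv x := by simp [mul_assoc]
  right_inv x := by simp [mul_assoc]
  map_mul' x y := by simp [mul_assoc]
  map_add' x y := by simp [mul_add, add_mul]

/-- The quotient of a ring by its Jacobson radical. -/
abbrev Residue (Γ : Type*) [Ring Γ] : Type _ := Γ ⧸ Ring.jacobson Γ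

theorem map_mem_jacobson {Γ : Type*} [Ring Γ] (φ : RingAut Γ) {x : Γ}
    (hx : x ∈ Ring.jacobson Γ) : φ x ∈ Ring.jacobson Γ := by
  have : RingHomSurjective (φ : Γ →+* Γ) := ⟨φ.surjective⟩
  exact Ring.le_comap_jacobson (φ : Γ →+* Γ) hx

/-- The canonical homomorphism `Aut Γ → Aut (Γ / rad Γ)`. -/
def residueAut (Γ : Type*) [Ring Γ] : RingAut Γ →* RingAut (Residue Γ) where
  toFun φ :=
    RingEquiv.ofRingHom
      (Ideal.quotientMap (Ring.jacobson Γ) (φ : Γ →+* Γ) fun _ hx => map_mem_jacobson φ hx)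
      (Ideal.quotientMap (Ring.jacobson Γ) ((φ⁻¹ : RingAut Γ) : Γ →+* Γ)
        fun _ hx => map_mem_jacobson φ⁻¹ hx)
      (by
        apply Ideal.Quotient.ringHom_ext
        ext x
        exact congrArg (Ideal.Quotient.mk _) (φ.apply_symm_apply x))
      (by
        apply Ideal.Quotient.ringHom_ext
        ext x
        exact congrArg (Ideal.Quotient.mk _) (φ.symm_apply_apply x))
  map_one' := by
    ext z
    obtain ⟨x, rfl⟩ := Ideal.Quotient.mk_surjective z
    rfl
  map_mul' φ ψ := by
    ext z
    obtain ⟨x, rfl⟩ := Ideal.Quotient.mk_surjective z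
    rfl

/-- `w` generates the Jacobson radical of `Γ`, both as a left and as a right ideal:
`rad Γ = w Γ = Γ w`. -/
def IsUniformizer {Γ : Type*} [Ring Γ] (w : Γ) : Prop :=
  (∀ x, x ∈ Ring.jacobson Γ ↔ ∃ y, x = w * y) ∧ (∀ x, x ∈ Ring.jacobson Γ ↔ ∃ y, x = y * w)

/-- An `R`-order in the `K`-algebra `A`, where `K` is the quotient field of `R`: a subring
that is a finitely generated `R`-submodule and spans `A` over `K`. -/
def IsOrder (R K : Type*) {A : Type*} [CommRing R] [Field K] [Ring A] [Algebra R A] [Algebra K A]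
    (O : Subalgebra R A) : Prop :=
  (Subalgebra.toSubmodule O).FG ∧ Submodule.span K (O : Set A) = ⊤

/-- A maximal `R`-order in `A` (with respect to inclusion). -/
def IsMaximalOrder (R K : Type*) {A : Type*} [CommRing R] [Field K] [Ring A] [Algebra R A]
    [Algebra K A] (O : Subalgebra R A) : Prop :=
  Maximal (IsOrder R K) O

/-- The unit `u` of `A` normalizes the subring `S`: `u S u⁻¹ = S`. -/
def Normalizes {R A : Type*} [CommRing R] [Ring A] [Algebra R A] (u : Aˣ) (S : Subalgebra R A) :
    Prop :=
  Ad u '' (S : Set A) = S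

/-- The automorphism `x ↦ u x u⁻¹` of a subring `S` of `A` that is normalized by `u`. -/
def conjAut {R A : Type*} [CommRing R] [Ring A] [Algebra R A] (u : Aˣ) (S : Subalgebra R A)
    (h : Normalizes u S) : RingAut S where
  toFun x := ⟨Ad u x, by
    have : Ad u x ∈ Ad u '' (S : Set A) := ⟨x, x.2, rfl⟩
    rwa [h] at this⟩
  invFun x := ⟨(Ad u).symm x, by
    have hx : (x : A) ∈ Ad u '' (S : Set A) := by rw [h]; exact x.2
    obtain ⟨y, hy, hyx⟩ := hx
    rw [← hyx, RingEquiv.symm_apply_apply]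
    exact hy⟩
  left_inv x := by simp
  right_inv x := by simp
  map_mul' x y := by ext; simp
  map_add' x y := by ext; simp

end General

section StandardOrder

variable {R F : Type*} [CommRing R] [Ring F] [Algebra R F] (O : Subalgebra R F)

/-- The Jacobson radical `I` of `O`, as a subset of the ambient ring `F`. -/
def radSet : Set F := {x | ∃ h : x ∈ O, (⟨x, h⟩ : O) ∈ Ring.jacobson O}

variable {O} in
theorem radSet_subset {x : F} (h : x ∈ radSet O) : x ∈ O := h.1

variable {O} in
theorem radSet_zero : (0 : F) ∈ radSet O := ⟨O.zero_mem, (Ring.jacobson O).zero_mem⟩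

variable {O} in
theorem radSet_add {x y : F} (hx : x ∈ radSet O) (hy : y ∈ radSet O) : x + y ∈ radSet O :=
  ⟨O.add_mem hx.1 hy.1, (Ring.jacobson O).add_mem hx.2 hy.2⟩

variable {O} in
theorem radSet_mul_left {x y : F} (hx : x ∈ O) (hy : y ∈ radSet O) : x * y ∈ radSet O :=
  ⟨O.mul_mem hx hy.1, (Ring.jacobson O).mul_mem_left ⟨x, hx⟩ hy.2⟩

variable {O} in
theorem radSet_mul_right {x y : F} (hx : x ∈ radSet O) (hy : y ∈ O) : x * y ∈ radSet O :=
  ⟨O.mul_mem hx.1 hy, (Ring.jacobson O).mul_mem_right ⟨y, hy⟩ hx.2⟩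

variable {O} in
theorem radSet_sum {ι : Type*} (s : Finset ι) (f : ι → F) (h : ∀ k ∈ s, f k ∈ radSet O) :
    ∑ k ∈ s, f k ∈ radSet O :=
  Finset.sum_induction f (· ∈ radSet O) (fun _ _ => radSet_add) radSet_zero h

variable {r : ℕ} (p : Fin r → ℕ)

/-- Row and column indices of `p × p` matrices, `p = p₁ + ⋯ + pᵣ`, cut into blocks of sizes
`p₁, …, pᵣ`: the pair `⟨i, a⟩` is the `a`-th index of the `i`-th block. -/
abbrev Idx : Type := Σ i : Fin r, Fin (p i)

/-- The standard order `H(O, p)`: matrices whose entries lie in `O` in the blocks on and below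
the diagonal, and in the Jacobson radical of `O` in the blocks above the diagonal. -/
def standardOrder : Subalgebra R (Matrix (Idx p) (Idx p) F) where
  carrier := {x | ∀ a b : Idx p, x a b ∈ O ∧ (a.1 < b.1 → x a b ∈ radSet O)}
  mul_mem' {x y} hx hy a b := by
    rw [Matrix.mul_apply]
    refine ⟨O.sum_mem fun k _ => O.mul_mem (hx a k).1 (hy k b).1, fun hab => ?_⟩
    refine radSet_sum _ _ fun k _ => ?_
    rcases lt_or_ge a.1 k.1 with h | h
    · exact radSet_mul_right ((hx a k).2 h) (hy k b).1
    · exact radSet_mul_left (hx a k).1 ((hy k b).2 (lt_of_le_of_lt h hab))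
  add_mem' {x y} hx hy a b :=
    ⟨O.add_mem (hx a b).1 (hy a b).1, fun h => radSet_add ((hx a b).2 h) ((hy a b).2 h)⟩
  algebraMap_mem' c a b := by
    rw [Matrix.algebraMap_matrix_apply]
    split_ifs with hab
    · exact ⟨O.algebraMap_mem c, fun h => absurd h (by simp [hab])⟩
    · exact ⟨O.zero_mem, fun _ => radSet_zero⟩

variable {O p} in
/-- The entry of an element of `H(O, p)` at a given position, as an element of `O`. -/
def entry (x : standardOrder O p) (a b : Idx p) : O := ⟨x.1 a b, (x.2 a b).1⟩

variable {O} in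
/-- The entrywise action of an automorphism of `O` on `H(O, p)`, as a ring homomorphism. -/
def inducedHom (ψ : RingAut O) : standardOrder O p →+* standardOrder O p where
  toFun x := ⟨Matrix.of fun a b => (ψ (entry x a b) : F), fun a b =>
    ⟨(ψ (entry x a b)).2, fun h =>
      ⟨(ψ (entry x a b)).2, map_mem_jacobson ψ ((x.2 a b).2 h).2⟩⟩⟩
  map_one' := by
    ext a b
    have : entry (1 : standardOrder O p) a b = if a = b then 1 else 0 := by
      ext
      change (1 : Matrix (Idx p) (Idx p) F) a b = _
      rw [Matrix.one_apply]; split_ifs <;> rfl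
    change (ψ (entry (1 : standardOrder O p) a b) : F) = (1 : Matrix (Idx p) (Idx p) F) a b
    rw [this, Matrix.one_apply]; split_ifs <;> simp
  map_zero' := by
    ext a b
    change (ψ (0 : O) : F) = 0
    simp
  map_mul' x y := by
    ext a b
    have : entry (x * y) a b = ∑ k, entry x a k * entry y k b := by
      ext
      change (x.1 * y.1) a b = _
      rw [Matrix.mul_apply]
      simp [entry]
    change (ψ (entry (x * y) a b) : F) = ∑ k, (ψ (entry x a k) : F) * (ψ (entry y k b) : F)
    rw [this]; simp
  map_add' x y := by
    ext a b
    change (ψ (entry x a b + entry y a b) : F) = (ψ (entry x a b) : F) + (ψ (entry y a b) : F)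
    simp

variable {O} in
/-- The automorphism of `H(O, p)` induced by an automorphism `ψ` of `O`: apply `ψ` to each
entry. -/
def inducedAut (ψ : RingAut O) : RingAut (standardOrder O p) :=
  RingEquiv.ofRingHom (inducedHom p ψ) (inducedHom p ψ⁻¹)
    (by ext x a b; exact congrArg Subtype.val (ψ.apply_symm_apply (entry x a b)))
    (by ext x a b; exact congrArg Subtype.val (ψ.symm_apply_apply (entry x a b)))

/-- The vector `p` is the concatenation of `r / t` copies of `(p₁, …, pₜ)`. -/
def IsRepetition (t : ℕ) : Prop :=
  1 ≤ t ∧ t ∣ r ∧ ∀ i j : Fin r, (i : ℕ) % t = (j : ℕ) % t → p i = p j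

/-- `t` is the least number such that `p = (p₁, …, pₜ; …; p₁, …, pₜ)`. -/
def IsMinimalPeriod (t : ℕ) : Prop := IsLeast {s | IsRepetition p s} t

/-- The rotation matrix `ϱ`: in blocks of size `q = p₁ + ⋯ + pₜ` it has identity blocks just
below the diagonal, the block `w • 1` in the upper right corner, and zero blocks elsewhere. (When
there is a single block of size `q`, it is `w • 1`.) -/
def rotation (t : ℕ) (w : F) : Matrix (Idx p) (Idx p) F :=
  Matrix.of fun a b =>
    if (a.1 : ℕ) = b.1 + t ∧ (a.2 : ℕ) = b.2 then 1
    else if (a.1 : ℕ) + r = b.1 + t ∧ (a.2 : ℕ) = b.2 then w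
    else 0

/-- The product `M_{p₁}(k) × ⋯ × M_{pᵣ}(k)`. -/
abbrev BlockProduct (k : Type*) : Type _ := (i : Fin r) → Matrix (Fin (p i)) (Fin (p i)) k

/-- The automorphism of `M_{p₁}(k) × ⋯ × M_{pᵣ}(k)` that applies `χ` to all entries. -/
def entrywiseAut {k : Type*} [Ring k] (χ : RingAut k) : RingAut (BlockProduct p k) :=
  RingEquiv.piCongrRight fun _ => RingEquiv.mapMatrix χ

/-- The position from which a cyclic shift by `t` places to the right fetches the `i`-th
component. -/
def shiftSource {p : Fin r → ℕ} {t : ℕ} (ht : IsMinimalPeriod p t) (i : Fin r) : Fin r :=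
  if h : (i : ℕ) < t then ⟨i + (r - t), by
    have := Nat.le_of_dvd (i.pos) ht.1.2.1
    omega⟩
  else ⟨i - t, by omega⟩

theorem size_shiftSource {p : Fin r → ℕ} {t : ℕ} (ht : IsMinimalPeriod p t) (i : Fin r) :
    p i = p (shiftSource ht i) := by
  refine ht.1.2.2 _ _ ?_
  obtain ⟨h1, ⟨l, rfl⟩, -⟩ := ht.1
  unfold shiftSource
  split_ifs with h
  · have : t * l - t = t * (l - 1) := by rw [Nat.mul_sub, mul_one]
    simp [this]
  · exact (Nat.mod_eq_sub_mod (not_lt.mp h))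

/-- The twisted cyclic shift
`(z₁, …, zᵣ) ↦ (κ(z_{r-t+1}), …, κ(zᵣ), z₁, …, z_{r-t})` of `M_{p₁}(k) × ⋯ × M_{pᵣ}(k)`. -/
def twistedShift {p : Fin r → ℕ} {t : ℕ} (ht : IsMinimalPeriod p t) {k : Type*} [Ring k]
    (κ : RingAut k) (z : BlockProduct p k) : BlockProduct p k := fun i =>
  Matrix.of fun a b =>
    let c : k := z (shiftSource ht i) (Fin.cast (size_shiftSource ht i) a)
      (Fin.cast (size_shiftSource ht i) b)
    if (i : ℕ) < t then κ c else c

end StandardOrder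

/-- The automorphism of `B` which the automorphism `φ` of `Γ` induces through an isomorphism
`e : Γ / rad Γ ≅ B`. -/
def inducedOn {Γ B : Type*} [Ring Γ] [Ring B] (e : Residue Γ ≃+* B) (φ : RingAut Γ) :
    RingAut B :=
  (e.symm.trans (residueAut Γ φ)).trans e

end HereditaryOrder

open HereditaryOrder

/-! Completeness of `R` makes `O` local (`IsOrder.isLocalRing`), so `rad O` is the set of nonunits,
`O / rad O` is a skew field, and the radical of `H` is the kernel of the reduction of the diagonal
blocks (`jacobson_standardOrder`). Units lift along the radical. The induced automorphisms can then
be read off from entries.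

For generation, let `φ` be an automorphism of `H`. The images of the diagonal matrix units are
orthogonal idempotents, nonzero modulo the radical; linear algebra over the residue skew field
together with lifting of units makes them, after an inner automorphism, a permutation `σ` of the
diagonal matrix units (`exists_conj_diagUnit`). Such an automorphism is an entrywise automorphism
followed by conjugation with a monomial matrix over `F`, whose entries are units of `O` times powers
of `w` (`exists_monomial_form`).

Whether a block lies above the diagonal is recorded by an exponent 0 or 1 of `w`. Comparing
exponents before and after `φ` gives an inequality (`blockExp_add_le`) that forces `σ` to rotate the
blocks cyclically by some `s` (`exists_cyclic_shift`). A rotation must preserve the block sizes,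
hence `t ∣ s` by minimality of `t` (`IsMinimalPeriod.dvd_shift`). Dividing by the power `s / t` of
the conjugation with `ϱ` leaves a permutation inside the blocks, and the monomial matrix becomes a
unit of `H` (`exists_eq_Ad_mul_inducedAut`). -/

namespace HereditaryOrder

/-! ### Orders over a complete discrete valuation ring are local. -/

section Local

open IsLocalRing

/-- A finite module over a complete Noetherian local ring is complete. -/
theorem isAdicComplete_of_finite {R M : Type*} [CommRing R] [IsLocalRing R] [IsNoetherianRing R]
    [IsAdicComplete (maximalIdeal R) R] [AddCommGroup M] [Module R M] [Module.Finite R M] :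
    IsAdicComplete (maximalIdeal R) M := by
  have hp : IsPrecomplete (maximalIdeal R) M := by
    rw [← AdicCompletion.of_surjective_iff]
    intro z
    -- For finite `M` the completion is a quotient of `R̂ ⊗ M`, and every element of `R̂` comes from
    -- `R`.
    obtain ⟨y, rfl⟩ := AdicCompletion.ofTensorProduct_surjective_of_finite (maximalIdeal R) M z
    induction y with
    | zero => exact ⟨0, by simp⟩
    | add a b ha hb =>
      obtain ⟨a', ha⟩ := ha
      obtain ⟨b', hb⟩ := hb
      exact ⟨a' + b', by simp [ha, hb]⟩
    | tmul c m =>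
      obtain ⟨c, rfl⟩ := AdicCompletion.of_surjective (maximalIdeal R) R c
      refine ⟨c • m, ?_⟩
      rw [AdicCompletion.ofTensorProduct_tmul]
      ext n
      rw [map_smul, AdicCompletion.val_smul_apply, AdicCompletion.smul_eval]
      rfl
  exact { toIsPrecomplete := hp, toIsHausdorff := inferInstance }

/-- A domain that is finite over a complete Noetherian local ring is local. -/
theorem isLocalRing_of_finite {R A : Type*} [CommRing R] [IsLocalRing R] [IsNoetherianRing R]
    [IsAdicComplete (maximalIdeal R) R] [CommRing A] [IsDomain A] [Algebra R A]
    [Module.Finite R A] : IsLocalRing A := by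
  set J := (maximalIdeal R).map (algebraMap R A)
  have hc : IsAdicComplete (maximalIdeal R) A := isAdicComplete_of_finite
  have hc' : IsAdicComplete J A :=
    { toIsPrecomplete := IsPrecomplete.map_algebraMap_iff.mpr hc.toIsPrecomplete
      toIsHausdorff := IsHausdorff.map_algebraMap_iff.mpr hc.toIsHausdorff }
  have hH : HenselianRing A J := inferInstance
  have hloc : IsLocalHom (Ideal.Quotient.mk J) := isLocalHom_of_le_jacobson_bot J hH.jac
  have hart : IsArtinianRing (A ⧸ J) := by
    let _ : Field (R ⧸ maximalIdeal R) := Ideal.Quotient.field _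
    let _ : Algebra (R ⧸ maximalIdeal R) (A ⧸ J) := Ideal.Quotient.algebraQuotientMapQuotient
    have : IsScalarTower R (R ⧸ maximalIdeal R) (A ⧸ J) := inferInstance
    have : Module.Finite (R ⧸ maximalIdeal R) (A ⧸ J) :=
      Module.Finite.of_restrictScalars_finite R _ _
    exact IsArtinianRing.of_finite (R ⧸ maximalIdeal R) (A ⧸ J)
  refine IsLocalRing.of_isUnit_or_isUnit_one_sub_self fun x => ?_
  set q := Ideal.Quotient.mk J
  -- The powers of `x` stabilise in the Artinian ring `A / J`, which makes `(x * y) ^ n` idempotent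
  -- modulo `J`. Hensel's lemma lifts it to an idempotent of the domain `A`, that is, to 0 or 1: in
  -- the first case `x` is nilpotent modulo `J`, in the second it is a unit there.
  obtain ⟨n, y, hy⟩ := IsArtinian.exists_pow_succ_smul_dvd (q x) (1 : A ⧸ J)
  obtain ⟨y, rfl⟩ := Ideal.Quotient.mk_surjective y
  change (q x) ^ (n + 1) * q y = q x ^ n * 1 at hy
  have h1 : ∀ k : ℕ, q x ^ n * (q x * q y) ^ k = q x ^ n := by
    intro k
    induction k with
    | zero => simp
    | succ k ih =>
      rw [pow_succ, ← mul_assoc, ih, ← mul_assoc, ← pow_succ, hy, mul_one]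
  have h2 : (q x * q y) ^ n * (q x * q y) ^ n = (q x * q y) ^ n := by
    calc _ = q y ^ n * (q x ^ n * (q x * q y) ^ n) := by rw [mul_pow]; ring
      _ = _ := by rw [h1, mul_pow]; ring
  obtain ⟨e, he, he'⟩ := hH.is_henselian (Polynomial.X ^ 2 - Polynomial.X)
    (Polynomial.monic_X_pow_sub (by simp)) ((x * y) ^ n)
    (by
      rw [← Ideal.Quotient.eq_zero_iff_mem]
      simp only [Polynomial.eval_sub, Polynomial.eval_pow, Polynomial.eval_X, map_sub, map_pow,
        map_mul]
      rw [sq, h2, sub_self])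
    (by
      have hd : (Polynomial.derivative (Polynomial.X ^ 2 - Polynomial.X : Polynomial A)).eval
          ((x * y) ^ n) = 2 * (x * y) ^ n - 1 := by simp [one_add_one_eq_two]
      -- For an idempotent `ε`, `2ε - 1` is its own inverse.
      refine IsUnit.of_mul_eq_one (2 * (q x * q y) ^ n - 1) ?_
      rw [hd, map_sub, map_one, map_mul, map_pow, map_mul, map_ofNat]
      linear_combination 4 * h2)
  have he2 : e * (e - 1) = 0 := by
    have := he
    simp only [Polynomial.IsRoot, Polynomial.eval_sub, Polynomial.eval_pow,
      Polynomial.eval_X] at this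
    linear_combination this
  have hqe : q e = (q x * q y) ^ n := by
    rw [← map_mul, ← map_pow]
    exact Ideal.Quotient.eq.mpr he'
  rcases mul_eq_zero.mp he2 with h | h
  · right
    have hnil : IsNilpotent (q x) := ⟨n, by rw [← h1 n, ← hqe, h, map_zero, mul_zero]⟩
    have := hnil.isUnit_one_sub
    rw [← map_one q, ← map_sub] at this
    exact hloc.map_nonunit _ this
  · left
    rw [sub_eq_zero] at h
    rw [h, map_one] at hqe
    rcases Nat.eq_zero_or_pos n with rfl | hn
    · have : q x * q y = 1 := by simpa using hy
      exact hloc.map_nonunit _ (IsUnit.of_mul_eq_one _ this)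
    · have : IsUnit (q x * q y) := (isUnit_pow_iff hn.ne').mp (hqe ▸ isUnit_one)
      exact hloc.map_nonunit _ (isUnit_of_mul_isUnit_left this)

/-- An order in a division algebra over a complete discretely valued field is a local ring. -/
theorem IsOrder.isLocalRing {R K F : Type*} [CommRing R] [IsDomain R]
    [IsDiscreteValuationRing R] [IsAdicComplete (maximalIdeal R) R] [Field K] [DivisionRing F]
    [Algebra K F] [Algebra R F] {O : Subalgebra R F} (hO : IsOrder R K O) : IsLocalRing O := by
  refine IsLocalRing.of_isUnit_or_isUnit_one_sub_self fun x => ?_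
  -- Locality is tested on one element at a time, so the commutative domain `R[x]` suffices; it is
  -- finite over `R` as a submodule of `O`.
  let A : Subalgebra R F := Algebra.adjoin R {(x : F)}
  have hAO : A ≤ O := Algebra.adjoin_le (by simp)
  have : IsMulCommutative A := Algebra.isMulCommutative_adjoin R (by
    intro a ha b hb
    rw [Set.mem_singleton_iff] at ha hb
    rw [ha, hb])
  have : IsDomain A := @NoZeroDivisors.to_isDomain A _ _ _
  have : Module.Finite R O := Module.Finite.iff_fg.mpr hO.1
  have : Module.Finite R A :=
    Module.Finite.of_injective (Subalgebra.inclusion hAO).toLinearMap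
      (Subalgebra.inclusion_injective hAO)
  have hA : IsLocalRing A := isLocalRing_of_finite (R := R)
  let x' : A := ⟨x, Algebra.self_mem_adjoin_singleton R _⟩
  have hx : Subalgebra.inclusion hAO x' = x := rfl
  rcases IsLocalRing.isUnit_or_isUnit_one_sub_self x' with h | h
  · exact Or.inl (hx ▸ h.map (Subalgebra.inclusion hAO))
  · right
    have := h.map (Subalgebra.inclusion hAO)
    rwa [map_sub, map_one, hx] at this

end Local

/-! ### The radical of a local order in a skew field. -/

section LocalDivision

variable {R F : Type*} [CommRing R] [DivisionRing F] [Algebra R F] {O : Subalgebra R F}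

/-- The radical of a local ring inside a division ring consists of the nonunits. -/
theorem mem_jacobson_iff_not_isUnit [IsLocalRing O] {x : O} :
    x ∈ Ring.jacobson O ↔ ¬ IsUnit x := by
  constructor
  · rintro hx ⟨u, rfl⟩
    have : (1 : O) ∈ Ring.jacobson O := by
      simpa using (Ring.jacobson O).mul_mem_left (↑u⁻¹ : O) hx
    exact (Ring.jacobson_lt_top O).ne ((Ideal.eq_top_iff_one _).mpr this)
  · intro hx
    rw [← Ideal.jacobson_bot, Ideal.mem_jacobson_iff]
    intro y
    have h1 : ¬ IsUnit (-(y * x)) := by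
      rintro h
      obtain ⟨u, hu⟩ := h.neg
      rw [neg_neg] at hu
      refine hx (IsUnit.of_mul_eq_one_right ((↑u⁻¹ : O) * y) ?_)
      rw [mul_assoc, ← hu, Units.inv_mul]
    obtain ⟨u, hu⟩ := (IsLocalRing.isUnit_or_isUnit_of_add_one
      (add_sub_cancel (-(y * x)) 1)).resolve_left h1
    refine ⟨(↑u⁻¹ : O), ?_⟩
    have h2 : (↑u⁻¹ : O) * (1 - -(y * x)) = 1 := by rw [← hu, Units.inv_mul]
    rw [Ideal.mem_bot, ← sub_eq_zero.mpr h2]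
    noncomm_ring

/-- A uniformizer of an order is nonzero. -/
theorem IsUniformizer.ne_zero {R K F : Type*} [CommRing R] [IsDomain R]
    [IsDiscreteValuationRing R] [IsAdicComplete (IsLocalRing.maximalIdeal R) R]
    [Field K] [Algebra R K] [IsFractionRing R K]
    [DivisionRing F] [Algebra K F] [Algebra R F] [IsScalarTower R K F]
    {O : Subalgebra R F} (hO : IsOrder R K O) {w : O} (hw : IsUniformizer w) : (w : F) ≠ 0 := by
  intro h0
  have hloc : IsLocalRing O := hO.isLocalRing
  obtain ⟨π, hπ⟩ := IsDiscreteValuationRing.exists_irreducible R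
  have hinj : Function.Injective (algebraMap R F) := by
    rw [IsScalarTower.algebraMap_eq R K F]
    exact (algebraMap K F).injective.comp (IsFractionRing.injective R K)
  have hfin : Module.Finite R O := Module.Finite.iff_fg.mpr hO.1
  -- If `π` were a unit of `O`, then `π⁻¹` would be integral over the integrally closed ring `R`. So
  -- `rad O` contains the nonzero element `π` and is not generated by 0.
  have hmem : algebraMap R O π ∈ Ring.jacobson O := by
    rw [mem_jacobson_iff_not_isUnit]
    rintro ⟨u, hu⟩
    have hint : IsIntegral R ((↑u⁻¹ : O) : F) :=
      (Algebra.IsIntegral.isIntegral (R := R) (↑u⁻¹ : O)).map O.val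
    have huF : ((↑u⁻¹ : O) : F) = algebraMap K F (algebraMap R K π)⁻¹ := by
      have h1 : ((↑u⁻¹ : O) : F) * algebraMap R F π = 1 := by
        have := congrArg Subtype.val u.inv_mul
        rw [hu] at this
        exact this
      rw [eq_inv_of_mul_eq_one_left h1, map_inv₀, ← IsScalarTower.algebraMap_apply]
    rw [huF, isIntegral_algebraMap_iff (algebraMap K F).injective] at hint
    obtain ⟨y, hy⟩ := IsIntegrallyClosed.isIntegral_iff.mp hint
    have hπ0 : algebraMap R K π ≠ 0 := by
      rw [Ne, IsFractionRing.to_map_eq_zero_iff]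
      exact hπ.ne_zero
    refine hπ.not_isUnit (IsUnit.of_mul_eq_one y (IsFractionRing.injective R K ?_))
    rw [map_mul, hy, map_one, mul_inv_cancel₀ hπ0]
  obtain ⟨y, hy⟩ := (hw.1 _).mp hmem
  have hw0 : w = 0 := Subtype.ext h0
  rw [hw0, zero_mul] at hy
  refine hπ.ne_zero (hinj ?_)
  rw [map_zero]
  exact congrArg Subtype.val hy

end LocalDivision

/-! ### Lifting units and inner automorphisms along the radical. -/

section Jacobson

variable {Γ B : Type*} [Ring Γ] [Ring B]

/-- A left inverse `z` of `1 + x` equals `1 - z * x`, which is again 1 plus a radical element, so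
`z` has a left inverse as well. -/
theorem isUnit_one_add_of_mem_jacobson {x : Γ} (hx : x ∈ Ring.jacobson Γ) : IsUnit (1 + x) := by
  have key : ∀ y ∈ Ring.jacobson Γ, ∃ z, z * (1 + y) = 1 := by
    intro y hy
    rw [← Ideal.jacobson_bot] at hy
    obtain ⟨z, hz⟩ := Ideal.mem_jacobson_iff.mp hy 1
    refine ⟨z, ?_⟩
    rw [Ideal.mem_bot, sub_eq_zero, mul_one] at hz
    rw [mul_add, mul_one, add_comm, hz]
  obtain ⟨z, hz⟩ := key x hx
  have hz1 : 1 + -(z * x) = z := by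
    rw [← hz]
    noncomm_ring
  obtain ⟨y, hy⟩ := key _ ((Ring.jacobson Γ).neg_mem ((Ring.jacobson Γ).mul_mem_left z hx))
  rw [hz1] at hy
  have : y = 1 + x := left_inv_eq_right_inv hy hz
  rw [this] at hy
  exact ⟨⟨1 + x, z, hy, hz⟩, rfl⟩

theorem isUnit_of_isUnit_mk_jacobson {x : Γ}
    (hx : IsUnit (Ideal.Quotient.mk (Ring.jacobson Γ) x)) : IsUnit x := by
  have lift : ∀ y : Γ, Ideal.Quotient.mk (Ring.jacobson Γ) y = 1 → IsUnit y := by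
    intro y hy
    rw [← map_one (Ideal.Quotient.mk (Ring.jacobson Γ)), Ideal.Quotient.eq] at hy
    simpa using isUnit_one_add_of_mem_jacobson hy
  obtain ⟨⟨_, y, h1, h2⟩, rfl⟩ := hx
  obtain ⟨y, rfl⟩ := Ideal.Quotient.mk_surjective y
  obtain ⟨u, hu⟩ := lift _ ((map_mul _ _ _).trans h1)
  obtain ⟨v, hv⟩ := lift _ ((map_mul _ _ _).trans h2)
  have hr : x * (y * (↑u⁻¹ : Γ)) = 1 := by rw [← mul_assoc, ← hu, Units.mul_inv]
  have hl : (↑v⁻¹ : Γ) * y * x = 1 := by rw [mul_assoc, ← hv, Units.inv_mul]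
  exact ⟨⟨x, _, hr, left_inv_eq_right_inv hl hr ▸ hl⟩, rfl⟩

/-- A nonzero idempotent does not lie in the Jacobson radical. -/
theorem eq_zero_of_mem_jacobson_of_idempotent {x : Γ} (hx : x ∈ Ring.jacobson Γ)
    (h : x * x = x) : x = 0 := by
  have hu : IsUnit (1 - x) := by
    simpa [sub_eq_add_neg] using isUnit_one_add_of_mem_jacobson ((Ring.jacobson Γ).neg_mem hx)
  refine hu.mul_left_cancel ?_
  rw [mul_zero, sub_mul, h, one_mul, sub_self]

theorem inducedOn_apply_mk (e : Residue Γ ≃+* B) (φ : RingAut Γ) (x : Γ) :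
    inducedOn e φ (e (Ideal.Quotient.mk _ x)) = e (Ideal.Quotient.mk _ (φ x)) := by
  unfold inducedOn
  rw [RingEquiv.trans_apply, RingEquiv.trans_apply, RingEquiv.symm_apply_apply]
  rfl

theorem exists_unit_lift (e : Residue Γ ≃+* B) (g : Bˣ) :
    ∃ u : Γˣ, e (Ideal.Quotient.mk _ (u : Γ)) = g := by
  obtain ⟨x, hx⟩ := Ideal.Quotient.mk_surjective (e.symm g)
  have hu : IsUnit x := isUnit_of_isUnit_mk_jacobson (hx ▸ g.isUnit.map e.symm)
  obtain ⟨u, rfl⟩ := hu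
  exact ⟨u, by rw [hx, RingEquiv.apply_symm_apply]⟩

theorem Ad_apply (u : Γˣ) (x : Γ) : Ad u x = u * x * (↑u⁻¹ : Γ) := rfl

theorem inducedOn_Ad (e : Residue Γ ≃+* B) (u : Γˣ) (g : Bˣ)
    (h : e (Ideal.Quotient.mk _ (u : Γ)) = g) : inducedOn e (Ad u) = Ad g := by
  ext z
  obtain ⟨z, rfl⟩ := e.surjective z
  obtain ⟨x, rfl⟩ := Ideal.Quotient.mk_surjective z
  have h' : e (Ideal.Quotient.mk _ (↑u⁻¹ : Γ)) = (↑g⁻¹ : B) := by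
    refine left_inv_eq_right_inv (a := (g : B)) ?_ g.mul_inv
    rw [← h, ← map_mul, ← map_mul, Units.inv_mul, map_one, map_one]
  rw [inducedOn_apply_mk, Ad_apply, Ad_apply, map_mul, map_mul, map_mul, map_mul, h, h']

/-- The inner automorphisms of a ring induce precisely the inner automorphisms of its
quotient by the radical. -/
theorem inducedOn_image_range_Ad (e : Residue Γ ≃+* B) :
    inducedOn e '' Set.range (Ad (Γ := Γ)) = Set.range (Ad (Γ := B)) := by
  ext φ
  constructor
  · rintro ⟨_, ⟨u, rfl⟩, rfl⟩
    exact ⟨(u.map (Ideal.Quotient.mk (Ring.jacobson Γ)).toMonoidHom).map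
      (e : Residue Γ →* B), (inducedOn_Ad e u _ rfl).symm⟩
  · rintro ⟨g, rfl⟩
    obtain ⟨u, hu⟩ := exists_unit_lift e g
    exact ⟨Ad u, ⟨u, rfl⟩, inducedOn_Ad e u g hu⟩

end Jacobson

/-! ### Reduction of the diagonal blocks. -/

section Reduction

variable {R F : Type*} [CommRing R] [Ring F] [Algebra R F] {O : Subalgebra R F}
  {r : ℕ} {p : Fin r → ℕ}

theorem entry_mul (x y : standardOrder O p) (a b : Idx p) :
    entry (x * y) a b = ∑ k, entry x a k * entry y k b := by
  ext
  change (x.1 * y.1) a b = _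
  rw [Matrix.mul_apply]
  simp [entry]

theorem entry_mem_jacobson (x : standardOrder O p) {a b : Idx p} (h : a.1 < b.1) :
    entry x a b ∈ Ring.jacobson O := ((x.2 a b).2 h).2

/-- Reduction of the diagonal blocks modulo the radical of `O`. -/
def reduction (O : Subalgebra R F) (p : Fin r → ℕ) :
    standardOrder O p →+* BlockProduct p (Residue O) where
  toFun x i := Matrix.of fun a b => Ideal.Quotient.mk _ (entry x ⟨i, a⟩ ⟨i, b⟩)
  map_one' := by
    ext i a b
    change Ideal.Quotient.mk _ (entry (1 : standardOrder O p) ⟨i, a⟩ ⟨i, b⟩) =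
      (1 : Matrix _ _ (Residue O)) a b
    have : entry (1 : standardOrder O p) ⟨i, a⟩ ⟨i, b⟩ = if a = b then 1 else 0 := by
      ext
      change (1 : Matrix (Idx p) (Idx p) F) ⟨i, a⟩ ⟨i, b⟩ = _
      rw [Matrix.one_apply]
      by_cases h : a = b <;> simp [h]
    rw [this, Matrix.one_apply]
    split_ifs <;> simp
  map_zero' := by
    ext i a b
    exact map_zero (Ideal.Quotient.mk (Ring.jacobson O))
  map_add' x y := by
    ext i a b
    exact map_add (Ideal.Quotient.mk (Ring.jacobson O)) (entry x ⟨i, a⟩ ⟨i, b⟩)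
      (entry y ⟨i, a⟩ ⟨i, b⟩)
  map_mul' x y := by
    ext i a b
    change Ideal.Quotient.mk _ (entry (x * y) ⟨i, a⟩ ⟨i, b⟩) =
      ∑ k, Ideal.Quotient.mk _ (entry x ⟨i, a⟩ ⟨i, k⟩) * Ideal.Quotient.mk _ (entry y ⟨i, k⟩ ⟨i, b⟩)
    rw [entry_mul, map_sum, Fintype.sum_sigma, Finset.sum_eq_single i]
    · simp
    · intro j _ hj
      refine Finset.sum_eq_zero fun k _ => ?_
      -- A product passing through another block `j` has one factor strictly above the diagonal,
      -- hence in the radical.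
      rw [Ideal.Quotient.eq_zero_iff_mem]
      rcases lt_or_gt_of_ne hj with h | h
      · exact (Ring.jacobson O).mul_mem_left _ (entry_mem_jacobson y h)
      · exact (Ring.jacobson O).mul_mem_right _ (entry_mem_jacobson x h)
    · simp

theorem reduction_apply (x : standardOrder O p) (i : Fin r) (a b : Fin (p i)) :
    reduction O p x i a b = Ideal.Quotient.mk _ (entry x ⟨i, a⟩ ⟨i, b⟩) := rfl

theorem single_mem {a b : Idx p} {c : F} (hc : c ∈ O) (h : a.1 < b.1 → c ∈ radSet O) :
    Matrix.single a b c ∈ standardOrder O p := by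
  intro i j
  rw [Matrix.single_apply]
  split_ifs with hij
  · rw [← hij.1, ← hij.2]
    exact ⟨hc, h⟩
  · exact ⟨O.zero_mem, fun _ => radSet_zero⟩

theorem single_mem_of_le {a b : Idx p} {c : F} (hc : c ∈ O) (h : b.1 ≤ a.1) :
    Matrix.single a b c ∈ standardOrder O p :=
  single_mem hc fun h' => absurd h' (not_lt.mpr h)

theorem reduction_surjective : Function.Surjective (reduction O p) := by
  intro z
  choose y hy using fun (i : Fin r) (a b : Fin (p i)) => Ideal.Quotient.mk_surjective (z i a b)
  refine ⟨⟨Matrix.of fun a b => if h : b.1 = a.1 then (y a.1 a.2 (h ▸ b.2) : F) else 0, ?_⟩, ?_⟩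
  · intro a b
    rw [Matrix.of_apply]
    split_ifs with h
    · exact ⟨(y a.1 a.2 (h ▸ b.2)).2, fun h' => absurd h h'.ne'⟩
    · exact ⟨O.zero_mem, fun _ => radSet_zero⟩
  · ext i a b
    rw [reduction_apply, ← hy]
    congr 1
    ext
    simp [entry]

/-- A matrix unit multiple whose diagonal blocks vanish modulo `rad O` lies in the radical. -/
theorem single_mem_jacobson {a b : Idx p} {c : F} (hc : c ∈ O) (h : a.1 ≤ b.1 → c ∈ radSet O) :
    (⟨Matrix.single a b c, single_mem hc fun h' => h h'.le⟩ : standardOrder O p) ∈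
      Ring.jacobson (standardOrder O p) := by
  rw [← Ideal.jacobson_bot, Ideal.mem_jacobson_iff]
  intro y
  set X : standardOrder O p := ⟨Matrix.single a b c, single_mem hc fun h' => h h'.le⟩
  -- The sandwich `X * Z * X` depends on `Z` only through the scalar `(Z * X) b b`, so
  -- quasi-regularity of `y * X` reduces to invertibility of `1 + (y * X) b b` in `O`.
  have hv : entry (y * X) b b ∈ Ring.jacobson O := by
    have : entry (y * X) b b = entry y b a * ⟨c, hc⟩ := by
      ext
      change (y.1 * Matrix.single a b c) b b = y.1 b a * c
      simp
    rw [this]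
    rcases lt_or_ge b.1 a.1 with hab | hab
    · exact (Ring.jacobson O).mul_mem_right _ (entry_mem_jacobson y hab)
    · exact (Ring.jacobson O).mul_mem_left _ (h hab).2
  obtain ⟨u, hu⟩ := isUnit_one_add_of_mem_jacobson hv
  let s : standardOrder O p := ⟨Matrix.single b b ((↑u⁻¹ : O) : F),
    single_mem_of_le (↑u⁻¹ : O).2 le_rfl⟩
  refine ⟨1 - y * X * s, ?_⟩
  rw [Ideal.mem_bot]
  have hX : ∀ Z : standardOrder O p, X * Z * X = X * ⟨Matrix.single b b (entry (Z * X) b b : F),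
      single_mem_of_le (entry (Z * X) b b).2 le_rfl⟩ := by
    intro Z
    ext i j
    change (Matrix.single a b c * Z.1 * Matrix.single a b c) i j =
      (Matrix.single a b c * Matrix.single b b ((Z.1 * Matrix.single a b c) b b)) i j
    rw [Matrix.single_mul_mul_single, Matrix.single_mul_single_same, Matrix.mul_single_apply_same,
      mul_assoc]
  have h1 : X * s * (y * X) = X * ⟨Matrix.single b b ((↑u⁻¹ : O) * (entry (y * X) b b) : F),
      single_mem_of_le (O.mul_mem (↑u⁻¹ : O).2 (entry (y * X) b b).2) le_rfl⟩ := by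
    rw [← mul_assoc, mul_assoc X, hX]
    congr 3
    change (Matrix.single b b ((↑u⁻¹ : O) : F) * y.1 * Matrix.single a b c) b b =
      ((↑u⁻¹ : O) : F) * (y.1 * Matrix.single a b c) b b
    simp [mul_assoc]
  have h2 : X * s + X * s * (y * X) = X := by
    rw [h1, ← mul_add]
    ext i j
    change (Matrix.single a b c * (Matrix.single b b ((↑u⁻¹ : O) : F) +
      Matrix.single b b (((↑u⁻¹ : O) : F) * (entry (y * X) b b : F)))) i j = Matrix.single a b c i j
    have : ((↑u⁻¹ : O) : F) + ((↑u⁻¹ : O) : F) * (entry (y * X) b b : F) = 1 := by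
      have := congrArg Subtype.val u.inv_mul
      rw [hu, mul_add, mul_one] at this
      exact this
    rw [← Matrix.single_add, this]
    simp
  have h3 : (1 - y * X * s) * y * X + (1 - y * X * s) - 1 =
      y * (X - (X * s + X * s * (y * X))) := by
    simp only [mul_sub, sub_mul, mul_add, one_mul, mul_assoc]
    abel
  rw [h3, h2, sub_self, mul_zero]

end Reduction

/-! ### The residue ring of the standard order and the induced automorphisms. -/

section Residue

variable {R F : Type*} [CommRing R] [DivisionRing F] [Algebra R F] {O : Subalgebra R F}
  [IsLocalRing O] {r : ℕ} {p : Fin r → ℕ}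

/-- The Jacobson radical of the standard order. -/
theorem jacobson_standardOrder :
    Ring.jacobson (standardOrder O p) = RingHom.ker (reduction O p) := by
  ext x
  rw [RingHom.mem_ker]
  constructor
  · intro hx
    ext i a b
    rw [reduction_apply]
    change _ = (0 : Residue O)
    rw [Ideal.Quotient.eq_zero_iff_mem, mem_jacobson_iff_not_isUnit]
    rintro ⟨u, hu⟩
    -- A unit entry in a diagonal block would let `x` generate a diagonal matrix unit, a nonzero
    -- idempotent in the radical.
    let s : standardOrder O p := ⟨Matrix.single ⟨i, a⟩ ⟨i, a⟩ ((↑u⁻¹ : O) : F),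
      single_mem_of_le (↑u⁻¹ : O).2 le_rfl⟩
    let s' : standardOrder O p := ⟨Matrix.single ⟨i, b⟩ ⟨i, a⟩ 1, single_mem_of_le O.one_mem le_rfl⟩
    have h1 : s * x * s' ∈ Ring.jacobson (standardOrder O p) :=
      (Ring.jacobson _).mul_mem_right _ ((Ring.jacobson _).mul_mem_left _ hx)
    have h2 : s * x * s' =
        ⟨Matrix.single ⟨i, a⟩ ⟨i, a⟩ 1, single_mem_of_le O.one_mem le_rfl⟩ := by
      apply Subtype.ext
      change Matrix.single (⟨i, a⟩ : Idx p) (⟨i, a⟩ : Idx p) ((↑u⁻¹ : O) : F) * x.1 *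
        Matrix.single (⟨i, b⟩ : Idx p) (⟨i, a⟩ : Idx p) (1 : F) =
          Matrix.single (⟨i, a⟩ : Idx p) (⟨i, a⟩ : Idx p) (1 : F)
      have : ((↑u⁻¹ : O) : F) * x.1 ⟨i, a⟩ ⟨i, b⟩ = 1 := by
        have := congrArg Subtype.val u.inv_mul
        rw [hu] at this
        exact this
      rw [Matrix.single_mul_mul_single, this, mul_one]
    rw [h2] at h1
    have h3 := eq_zero_of_mem_jacobson_of_idempotent h1
      (Subtype.ext (by
        change Matrix.single _ _ (1 : F) * Matrix.single _ _ 1 = Matrix.single _ _ 1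
        simp))
    have h4 := congrFun (congrFun (congrArg Subtype.val h3) ⟨i, a⟩) ⟨i, a⟩
    simp at h4
  · intro hx
    have hsum : x = ∑ a, ∑ b, (⟨Matrix.single a b (x.1 a b),
        single_mem (x.2 a b).1 (x.2 a b).2⟩ : standardOrder O p) := by
      apply Subtype.ext
      conv_lhs => rw [Matrix.matrix_eq_sum_single x.1]
      simp only [AddSubmonoidClass.coe_finsetSum]
    rw [hsum]
    refine Submodule.sum_mem _ fun a _ => Submodule.sum_mem _ fun b _ => ?_
    refine single_mem_jacobson (x.2 a b).1 fun hab => ?_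
    rcases hab.lt_or_eq with h | h
    · exact (x.2 a b).2 h
    · obtain ⟨i, a⟩ := a
      obtain ⟨j, b⟩ := b
      obtain rfl : i = j := h
      have : reduction O p x i a b = 0 := by rw [hx]; rfl
      rw [reduction_apply, Ideal.Quotient.eq_zero_iff_mem] at this
      exact ⟨_, this⟩

/-- The isomorphism `H / rad H ≅ M_{p₁}(O / rad O) × ⋯ × M_{pᵣ}(O / rad O)`. -/
noncomputable def residueEquiv (O : Subalgebra R F) [IsLocalRing O] (p : Fin r → ℕ) :
    Residue (standardOrder O p) ≃+* BlockProduct p (Residue O) :=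
  RingEquiv.ofBijective
    (Ideal.Quotient.lift (Ring.jacobson (standardOrder O p)) (reduction O p) fun x hx => by
      rwa [jacobson_standardOrder] at hx)
    ⟨by
      rw [injective_iff_map_eq_zero]
      intro z hz
      obtain ⟨x, rfl⟩ := Ideal.Quotient.mk_surjective z
      rw [Ideal.Quotient.eq_zero_iff_mem, jacobson_standardOrder]
      exact hz,
    fun z => by
      obtain ⟨x, rfl⟩ := reduction_surjective z
      exact ⟨Ideal.Quotient.mk _ x, rfl⟩⟩

theorem residueEquiv_mk (x : standardOrder O p) :
    residueEquiv O p (Ideal.Quotient.mk _ x) = reduction O p x := rfl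

theorem inducedOn_residueEquiv_reduction (φ : RingAut (standardOrder O p))
    (x : standardOrder O p) :
    inducedOn (residueEquiv O p) φ (reduction O p x) = reduction O p (φ x) :=
  inducedOn_apply_mk (residueEquiv O p) φ x

theorem inducedOn_inducedAut (ψ : RingAut O) :
    inducedOn (residueEquiv O p) (inducedAut p ψ) = entrywiseAut p (residueAut O ψ) := by
  ext z i a b
  obtain ⟨x, rfl⟩ := reduction_surjective z
  rw [inducedOn_residueEquiv_reduction]
  rfl

theorem inducedOn_image_range_inducedAut :
    inducedOn (residueEquiv O p) '' Set.range (inducedAut (O := O) p) =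
      entrywiseAut p '' ((residueAut O).range : Set (RingAut (Residue O))) := by
  rw [MonoidHom.coe_range, ← Set.range_comp, ← Set.range_comp]
  exact congrArg Set.range (funext inducedOn_inducedAut)

end Residue

/-! ### Units normalizing a subring. -/

section Normalizer

variable {R A : Type*} [CommRing R] [Ring A] [Algebra R A] {S : Subalgebra R A}

theorem normalizes_iff {u : Aˣ} :
    Normalizes u S ↔ ∀ x : A, (u : A) * x * (↑u⁻¹ : A) ∈ S ↔ x ∈ S := by
  constructor
  · intro h x
    constructor
    · intro hx
      have : Ad u x ∈ Ad u '' (S : Set A) := by rw [h]; exact hx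
      obtain ⟨y, hy, hyx⟩ := this
      exact (Ad u).injective hyx ▸ hy
    · intro hx
      have : Ad u x ∈ Ad u '' (S : Set A) := ⟨x, hx, rfl⟩
      rw [h] at this
      exact this
  · intro h
    ext x
    constructor
    · rintro ⟨y, hy, rfl⟩
      exact (h y).mpr hy
    · intro hx
      refine ⟨(Ad u).symm x, (h _).mp ?_, (Ad u).apply_symm_apply x⟩
      change Ad u ((Ad u).symm x) ∈ S
      rw [(Ad u).apply_symm_apply]
      exact hx

theorem conjAut_apply (u : Aˣ) (h : Normalizes u S) (x : S) :
    (conjAut u S h x : A) = u * x * (↑u⁻¹ : A) := rfl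

theorem Normalizes.zpow {u : Aˣ} (h : Normalizes u S) (n : ℤ) : Normalizes (u ^ n) S := by
  rw [normalizes_iff] at h ⊢
  induction n with
  | zero => simp
  | succ n ih =>
    intro x
    rw [← ih x, ← h (((u ^ (n : ℤ) : Aˣ) : A) * x * ((u ^ (n : ℤ))⁻¹ : Aˣ)), add_comm,
      zpow_add, zpow_one]
    simp [mul_assoc]
  | pred n ih =>
    intro x
    rw [← ih x, ← h, zpow_sub_one]
    rw [((Commute.refl u).zpow_left (-n)).inv_right.eq]
    simp [mul_assoc]

end Normalizer

/-! ### The filtration of `F` by powers of a normalizing unit. -/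

section Filtration

variable {R F : Type*} [CommRing R] [DivisionRing F] [Algebra R F]

/-- `x` lies in the fractional ideal `ω ^ k O`. -/
def InPow (O : Subalgebra R F) (ω : Fˣ) (k : ℤ) (x : F) : Prop := ((ω ^ (-k) : Fˣ) : F) * x ∈ O

variable {O : Subalgebra R F} {ω : Fˣ}

theorem inPow_zero {x : F} : InPow O ω 0 x ↔ x ∈ O := by simp [InPow]

theorem inPow_zero_right (k : ℤ) : InPow O ω k 0 := by simp [InPow, O.zero_mem]

/-- Since `ω ^ n` normalizes `O`, left and right multiplication by powers of `ω` only move the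
level; this is the bookkeeping rule for all monomial conjugations below. -/
theorem inPow_conj (hω : Normalizes ω O) {k m n : ℤ} {x : F} :
    InPow O ω (k + m - n) (((ω ^ m : Fˣ) : F) * x * ((ω ^ (-n) : Fˣ) : F)) ↔ InPow O ω k x := by
  unfold InPow
  rw [← normalizes_iff.mp (hω.zpow n) (((ω ^ (-k) : Fˣ) : F) * x)]
  have h : ω ^ (-(k + m - n)) * ω ^ m = ω ^ n * ω ^ (-k) := by
    rw [← zpow_add, ← zpow_add]
    congr 1
    ring
  have h' : ((ω ^ (-(k + m - n)) : Fˣ) : F) * ((ω ^ m : Fˣ) : F) =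
      ((ω ^ n : Fˣ) : F) * ((ω ^ (-k) : Fˣ) : F) := by
    rw [← Units.val_mul, h, Units.val_mul]
  rw [← zpow_neg, ← mul_assoc, ← mul_assoc, ← mul_assoc, h']

theorem inPow_iff_right (hω : Normalizes ω O) {k : ℤ} {x : F} :
    InPow O ω k x ↔ x * ((ω ^ (-k) : Fˣ) : F) ∈ O := by
  rw [← inPow_conj hω (k := k) (m := 0) (n := k)]
  simp [InPow]

theorem inPow_mul_left (hω : Normalizes ω O) {k : ℤ} {x y : F} (hx : x ∈ O)
    (hy : InPow O ω k y) : InPow O ω k (x * y) := by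
  rw [inPow_iff_right hω] at hy ⊢
  rw [mul_assoc]
  exact O.mul_mem hx hy

theorem inPow_mul_right {k : ℤ} {x y : F} (hx : InPow O ω k x) (hy : y ∈ O) :
    InPow O ω k (x * y) := by
  unfold InPow at hx ⊢
  rw [← mul_assoc]
  exact O.mul_mem hx hy

end Filtration

/-! ### Uniformizers and the valuation they define. -/

section Uniformizer

variable {R F : Type*} [CommRing R] [DivisionRing F] [Algebra R F] {O : Subalgebra R F}
  {w : O} {ω : Fˣ}

theorem IsUniformizer.normalizes (hw : IsUniformizer w) (hω : (ω : F) = w) : Normalizes ω O := by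
  rw [normalizes_iff]
  intro x
  constructor
  · intro hx
    have h1 : (⟨_, hx⟩ * w : O) ∈ Ring.jacobson O := (hw.2 _).mpr ⟨_, rfl⟩
    obtain ⟨y, hy⟩ := (hw.1 _).mp h1
    have h2 : (ω : F) * x * (↑ω⁻¹ : F) * w = w * y := congrArg Subtype.val hy
    rw [← hω, Units.inv_mul_cancel_right] at h2
    rw [ω.isUnit.mul_left_cancel h2]
    exact y.2
  · intro hx
    have h1 : (w * ⟨x, hx⟩ : O) ∈ Ring.jacobson O := (hw.1 _).mpr ⟨_, rfl⟩
    obtain ⟨y, hy⟩ := (hw.2 _).mp h1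
    have h2 : (w : F) * x = y * w := congrArg Subtype.val hy
    rw [← hω] at h2
    rw [h2, Units.mul_inv_cancel_right]
    exact y.2

theorem IsUniformizer.mem_radSet_iff (hw : IsUniformizer w) (hω : (ω : F) = w) {x : F} :
    x ∈ radSet O ↔ InPow O ω 1 x := by
  unfold InPow
  constructor
  · rintro ⟨hx, hxJ⟩
    obtain ⟨y, hy⟩ := (hw.1 _).mp hxJ
    have h2 : x = w * y := congrArg Subtype.val hy
    rw [h2, ← hω]
    simp
  · intro h
    have hx : x = ω * (((ω ^ (-1 : ℤ) : Fˣ) : F) * x) := by simp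
    refine ⟨?_, (hw.1 _).mpr ⟨⟨_, h⟩, ?_⟩⟩
    · rw [hx, hω]
      exact O.mul_mem w.2 h
    · ext
      change x = w * (((ω ^ (-1 : ℤ) : Fˣ) : F) * x)
      rw [← hω]
      exact hx

theorem IsUniformizer.inv_notMem (hw : IsUniformizer w) (hω : (ω : F) = w) :
    (↑ω⁻¹ : F) ∉ O := by
  intro h
  have h1 : w ∈ Ring.jacobson O := (hw.1 _).mpr ⟨1, (mul_one w).symm⟩
  have h2 := (Ring.jacobson O).mul_mem_left ⟨_, h⟩ h1
  have h3 : (⟨_, h⟩ : O) * w = 1 := by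
    ext
    change (↑ω⁻¹ : F) * w = 1
    rw [← hω, Units.inv_mul]
  rw [h3] at h2
  exact (Ring.jacobson_lt_top O).ne ((Ideal.eq_top_iff_one _).mpr h2)

/-- The levels are strictly decreasing because `ω⁻¹ ∉ O`: a power of too small an exponent,
multiplied by a suitable element of `O`, would give `ω⁻¹`. -/
theorem IsUniformizer.inPow_zpow (hw : IsUniformizer w) (hω : (ω : F) = w) {k m : ℤ} :
    InPow O ω k ((ω ^ m : Fˣ) : F) ↔ k ≤ m := by
  have hnat : ∀ n : ℕ, ((ω ^ n : Fˣ) : F) ∈ O := by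
    intro n
    rw [Units.val_pow_eq_pow_val, hω]
    exact O.pow_mem w.2 n
  unfold InPow
  rw [← Units.val_mul, ← zpow_add]
  constructor
  · intro h
    by_contra hlt
    obtain ⟨n, hn⟩ : ∃ n : ℕ, k = m + 1 + n := ⟨(k - m - 1).toNat, by omega⟩
    refine hw.inv_notMem hω ?_
    have := O.mul_mem h (hnat n)
    rw [← Units.val_mul, ← zpow_natCast, ← zpow_add, hn] at this
    convert this using 2
    rw [← zpow_neg_one]
    congr 1
    ring
  · intro h
    obtain ⟨n, hn⟩ : ∃ n : ℕ, m = k + n := ⟨(m - k).toNat, by omega⟩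
    have := hnat n
    rw [← zpow_natCast] at this
    convert this using 3
    omega

theorem IsUniformizer.exists_unit_mul {w' : O} (hw : IsUniformizer w) (hw' : IsUniformizer w')
    (h0 : (w : F) ≠ 0) : ∃ u : Oˣ, w' = u * w := by
  obtain ⟨u, hu⟩ := (hw.2 w').mp ((hw'.2 w').mpr ⟨1, (one_mul _).symm⟩)
  obtain ⟨v, hv⟩ := (hw'.2 w).mp ((hw.2 w).mpr ⟨1, (one_mul _).symm⟩)
  have h1 : v * u = 1 := by
    ext
    have h2 : (w : F) = v * (u * w) := by
      have := congrArg Subtype.val hv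
      rw [hu] at this
      exact this
    refine mul_right_cancel₀ h0 ?_
    change (v : F) * u * w = 1 * w
    rw [one_mul, mul_assoc, ← h2]
  obtain ⟨u, rfl⟩ := IsUnit.of_mul_eq_one_right _ h1
  exact ⟨u, hu⟩

end Uniformizer

/-! ### Monomial matrices. -/

section Monomial

variable {F ι : Type*} [Ring F] [Fintype ι] [DecidableEq ι]

/-- The monomial matrix with entry `c a` at position `(a, τ a)` and zeros elsewhere. -/
def monomialUnit (τ : Equiv.Perm ι) (c : ι → Fˣ) : (Matrix ι ι F)ˣ where
  val := Matrix.of fun a b => if τ a = b then (c a : F) else 0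
  inv := Matrix.of fun a b => if a = τ b then (↑(c b)⁻¹ : F) else 0
  val_inv := by
    ext a b
    rw [Matrix.mul_apply, Finset.sum_eq_single (τ a)]
    · by_cases h : a = b
      · subst h
        simp
      · simp [h]
    · intro k _ hk
      simp [hk.symm]
    · simp
  inv_val := by
    ext a b
    rw [Matrix.mul_apply, Finset.sum_eq_single (τ.symm a)]
    · by_cases h : a = b
      · subst h
        simp
      · simp [h]
    · intro k _ hk
      have : a ≠ τ k := by
        rintro rfl
        simp at hk
      simp [this]
    · simp

theorem monomialUnit_apply (τ : Equiv.Perm ι) (c : ι → Fˣ) (a b : ι) :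
    (monomialUnit τ c : Matrix ι ι F) a b = if τ a = b then (c a : F) else 0 := rfl

theorem monomialUnit_inv_apply (τ : Equiv.Perm ι) (c : ι → Fˣ) (a b : ι) :
    ((monomialUnit τ c)⁻¹ : (Matrix ι ι F)ˣ).val a b = if a = τ b then (↑(c b)⁻¹ : F) else 0 := rfl

theorem monomialUnit_conj_apply (τ : Equiv.Perm ι) (c : ι → Fˣ) (x : Matrix ι ι F) (a b : ι) :
    ((monomialUnit τ c : Matrix ι ι F) * x * ((monomialUnit τ c)⁻¹ : (Matrix ι ι F)ˣ).val) a b =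
      c a * x (τ a) (τ b) * (↑(c b)⁻¹ : F) := by
  rw [Matrix.mul_apply, Finset.sum_eq_single (τ b)]
  · rw [monomialUnit_inv_apply, if_pos rfl, Matrix.mul_apply, Finset.sum_eq_single (τ a)]
    · rw [monomialUnit_apply, if_pos rfl]
    · intro k _ hk
      rw [monomialUnit_apply, if_neg hk.symm, zero_mul]
    · simp
  · intro k _ hk
    rw [monomialUnit_inv_apply, if_neg hk, mul_zero]
  · simp

end Monomial

/-! ### The rotation matrix and the twisted cyclic shift. -/

section Rotation

variable {r : ℕ} {p : Fin r → ℕ}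

/-- The exponent of the radical in the block containing the position `(a, b)`. -/
def blockExp (a b : Idx p) : ℤ := if a.1 < b.1 then 1 else 0

theorem mem_standardOrder_iff {R F : Type*} [CommRing R] [DivisionRing F] [Algebra R F]
    {O : Subalgebra R F} {w : O} {ω : Fˣ} (hw : IsUniformizer w) (hω : (ω : F) = w)
    {x : Matrix (Idx p) (Idx p) F} :
    x ∈ standardOrder O p ↔ ∀ a b, InPow O ω (blockExp a b) (x a b) := by
  change (∀ a b : Idx p, x a b ∈ O ∧ (a.1 < b.1 → x a b ∈ radSet O)) ↔ _
  refine forall_congr' fun a => forall_congr' fun b => ?_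
  unfold blockExp
  split_ifs with h
  · rw [← hw.mem_radSet_iff hω]
    exact ⟨fun H => H.2 h, fun H => ⟨H.1, fun _ => H⟩⟩
  · rw [inPow_zero]
    exact ⟨fun H => H.1, fun H => ⟨H, fun h' => absurd h' h⟩⟩

theorem IsMinimalPeriod.le {t : ℕ} (ht : IsMinimalPeriod p t) (hr : 0 < r) : t ≤ r :=
  Nat.le_of_dvd hr ht.1.2.1

variable {t : ℕ} (ht : IsMinimalPeriod p t)

theorem shiftSource_val (i : Fin r) :
    (shiftSource ht i : ℕ) = if (i : ℕ) < t then (i : ℕ) + (r - t) else (i : ℕ) - t := by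
  unfold shiftSource
  split_ifs <;> rfl

theorem shiftSource_injective : Function.Injective (shiftSource ht) := by
  intro i j h
  have h' := congrArg Fin.val h
  have hle := ht.le i.pos
  rw [shiftSource_val, shiftSource_val] at h'
  ext
  split_ifs at h' <;> omega

/-- The permutation of the indices underlying the cyclic shift. -/
noncomputable def shiftPerm : Equiv.Perm (Idx p) :=
  Equiv.ofBijective
    (fun a => (⟨shiftSource ht a.1, Fin.cast (size_shiftSource ht a.1) a.2⟩ : Idx p))
    (Finite.injective_iff_bijective.mp (by
      rintro ⟨i, a⟩ ⟨j, b⟩ h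
      obtain ⟨h1, h2⟩ := Sigma.mk.inj_iff.mp h
      obtain rfl := shiftSource_injective ht h1
      simpa using h2))

theorem shiftPerm_apply (a : Idx p) :
    shiftPerm ht a = ⟨shiftSource ht a.1, Fin.cast (size_shiftSource ht a.1) a.2⟩ := rfl

/-- The exponent of the uniformizer in the rows of the rotation matrix. -/
def wrapExp (t : ℕ) (i : Fin r) : ℤ := if (i : ℕ) < t then 1 else 0

/-- The shift keeps the order of two blocks unless exactly one of them is among the first `t`, which
are moved behind the others. The resulting change of exponent is compensated by the factors `w` in
`ϱ`, which is why `ϱ` normalizes `H`. -/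
theorem blockExp_shiftPerm (a b : Idx p) :
    blockExp a b = blockExp (shiftPerm ht a) (shiftPerm ht b) + wrapExp t a.1 - wrapExp t b.1 := by
  have hle := ht.le a.1.pos
  unfold blockExp wrapExp
  simp only [shiftPerm_apply, Fin.lt_def, shiftSource_val]
  split_ifs <;> omega

variable {R F : Type*} [CommRing R] [DivisionRing F] [Algebra R F] {O : Subalgebra R F}
  {w : O} {ω : Fˣ}

/-- The rotation matrix as a unit of the matrix ring. -/
noncomputable def rotationUnit (ω : Fˣ) : (Matrix (Idx p) (Idx p) F)ˣ :=
  monomialUnit (shiftPerm ht) fun a => ω ^ wrapExp t a.1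

theorem coe_rotationUnit (ω : Fˣ) :
    (rotationUnit ht ω : Matrix (Idx p) (Idx p) F) = rotation p t (ω : F) := by
  ext ⟨i, a⟩ ⟨j, b⟩
  have hle := ht.le i.pos
  rw [rotationUnit, monomialUnit_apply, rotation, Matrix.of_apply, shiftPerm_apply]
  have hiff : ((⟨shiftSource ht i, Fin.cast (size_shiftSource ht i) a⟩ : Idx p) = ⟨j, b⟩) ↔
      (shiftSource ht i : ℕ) = j ∧ (a : ℕ) = b := by
    constructor
    · intro h
      obtain ⟨rfl, h2⟩ := Sigma.mk.inj_iff.mp h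
      refine ⟨rfl, ?_⟩
      rw [← eq_of_heq h2]
      rfl
    · rintro ⟨h1, h2⟩
      obtain rfl := Fin.ext h1
      congr 1
      ext
      exact h2
  simp only [hiff, shiftSource_val, wrapExp]
  have hi := i.2
  have hj := j.2
  have ht1 := ht.1.1
  by_cases h2 : (a : ℕ) = b
  · simp only [h2, and_true]
    split_ifs <;> first | omega | simp
  · simp [h2]

theorem rotationUnit_normalizes (hw : IsUniformizer w) (hω : (ω : F) = w) :
    Normalizes (rotationUnit ht ω) (standardOrder O p) := by
  rw [normalizes_iff]
  intro x
  rw [mem_standardOrder_iff hw hω, mem_standardOrder_iff hw hω]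
  refine Iff.trans (forall_congr' fun a => ?_) (shiftPerm ht).forall_congr_right
  refine Iff.trans (forall_congr' fun b => ?_) (shiftPerm ht).forall_congr_right
  rw [rotationUnit, monomialUnit_conj_apply, blockExp_shiftPerm ht, ← zpow_neg,
    inPow_conj (hw.normalizes hω)]

theorem rotationUnit_conj_apply (ω : Fˣ) (x : Matrix (Idx p) (Idx p) F) (a b : Idx p) :
    ((rotationUnit ht ω : Matrix (Idx p) (Idx p) F) * x *
      ((rotationUnit ht ω)⁻¹ : (Matrix (Idx p) (Idx p) F)ˣ).val) a b =
      ((ω ^ wrapExp t a.1 : Fˣ) : F) * x (shiftPerm ht a) (shiftPerm ht b) *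
        ((ω ^ wrapExp t b.1 : Fˣ)⁻¹ : Fˣ) :=
  monomialUnit_conj_apply _ _ _ _ _

/-- Inside a diagonal block the row and column factors are the same power of `ω`: `ω` itself in the
first `t` blocks, giving the twist, and 1 elsewhere. -/
theorem inducedOn_conjAut_rotationUnit [IsLocalRing O] (hω : Normalizes ω O)
    (hϱ : Normalizes (rotationUnit ht ω) (standardOrder O p))
    (z : BlockProduct p (Residue O)) :
    inducedOn (residueEquiv O p) (conjAut (rotationUnit ht ω) (standardOrder O p) hϱ) z =
      twistedShift ht (residueAut O (conjAut ω O hω)) z := by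
  obtain ⟨x, rfl⟩ := reduction_surjective z
  rw [inducedOn_residueEquiv_reduction]
  ext i a b
  rw [reduction_apply, twistedShift, Matrix.of_apply]
  simp only [reduction_apply]
  split_ifs with h
  · change _ = Ideal.Quotient.mk _ (conjAut ω O hω _)
    congr 1
    ext
    rw [conjAut_apply]
    refine (rotationUnit_conj_apply ht ω x.1 _ _).trans ?_
    simp only [wrapExp, if_pos h, zpow_one]
    rfl
  · congr 1
    ext
    refine (rotationUnit_conj_apply ht ω x.1 _ _).trans ?_
    simp only [wrapExp, if_neg h, zpow_zero]
    simp [entry, shiftPerm_apply]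

/-- Twisted shifts whose twists differ by an inner automorphism differ by an inner
automorphism. -/
theorem exists_twistedShift_eq {k : Type*} [Ring k] (κ κ' : RingAut k) (u : kˣ)
    (h : ∀ c, κ' c = u * κ c * (↑u⁻¹ : k)) :
    ∃ g : (BlockProduct p k)ˣ, ∀ z, twistedShift ht κ' z = Ad g (twistedShift ht κ z) := by
  -- Only the first `t` blocks are twisted, so only they need conjugation by the scalar matrix `u`.
  let c : Fin r → kˣ := fun i => if (i : ℕ) < t then u else 1
  let g : (BlockProduct p k)ˣ :=
    { val := fun i => Matrix.diagonal fun _ => (c i : k)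
      inv := fun i => Matrix.diagonal fun _ => (↑(c i)⁻¹ : k)
      val_inv := by
        ext i : 1
        simp
      inv_val := by
        ext i : 1
        simp }
  refine ⟨g, fun z => ?_⟩
  ext i a b
  rw [Ad_apply]
  change _ = ((Matrix.diagonal fun _ => (c i : k) : Matrix (Fin (p i)) (Fin (p i)) k) *
    twistedShift ht κ z i *
    (Matrix.diagonal fun _ => (↑(c i)⁻¹ : k) : Matrix (Fin (p i)) (Fin (p i)) k)) a b
  rw [Matrix.mul_diagonal, Matrix.diagonal_mul]
  simp only [twistedShift, Matrix.of_apply, c]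
  split_ifs with hi
  · exact h _
  · simp

theorem IsUniformizer.exists_twistedShift_eq {w' : O} (hw : IsUniformizer w) (hω : (ω : F) = w)
    (hN : Normalizes ω O) (hw' : IsUniformizer w') :
    (∃ u : Oˣ, w' = u * w) ∧
      ∃ (ω' : Fˣ) (_ : (ω' : F) = w') (hω' : Normalizes ω' O)
        (g : (BlockProduct p (Residue O))ˣ),
        ∀ z, twistedShift ht (residueAut O (conjAut ω' O hω')) z =
          Ad g (twistedShift ht (residueAut O (conjAut ω O hN)) z) := by
  obtain ⟨u, hu⟩ := hw.exists_unit_mul hw' (hω ▸ ω.ne_zero)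
  refine ⟨⟨u, hu⟩, u.map (O.val : O →* F) * ω, ?_, ?_⟩
  · rw [hu, Units.val_mul, hω]
    rfl
  have hω' : ((u.map (O.val : O →* F) * ω : Fˣ) : F) = w' := by
    rw [hu, Units.val_mul, hω]
    rfl
  refine ⟨hw'.normalizes hω', ?_⟩
  -- Conjugation by `u * w` is conjugation by `w` followed by conjugation by `u`, and the latter is
  -- inner on `O / rad O`.
  refine HereditaryOrder.exists_twistedShift_eq ht _ _
    (u.map (Ideal.Quotient.mk (Ring.jacobson O)).toMonoidHom) fun c => ?_
  obtain ⟨x, rfl⟩ := Ideal.Quotient.mk_surjective c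
  change Ideal.Quotient.mk _ (conjAut _ O _ x) = Ideal.Quotient.mk _ (u : O) *
    Ideal.Quotient.mk _ (conjAut ω O hN x) * Ideal.Quotient.mk _ (↑u⁻¹ : O)
  rw [← map_mul, ← map_mul]
  congr 1
  ext
  rw [conjAut_apply]
  change _ = (u : F) * (conjAut ω O hN x : F) * ((↑u⁻¹ : O) : F)
  rw [conjAut_apply, mul_inv_rev, Units.val_mul, Units.val_mul]
  simp only [mul_assoc]
  rfl

end Rotation

/-! ### Orthogonal idempotents in products of matrix rings over a skew field. -/

section Idempotents

variable {r : ℕ} {p : Fin r → ℕ}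

/-- The diagonal matrix unit of `M_{p₁}(k) × ⋯ × M_{pᵣ}(k)` at the index `a`. -/
def blockUnit (k : Type*) [Ring k] (a : Idx p) : BlockProduct p k := fun i =>
  Matrix.diagonal fun b => if a = ⟨i, b⟩ then 1 else 0

/-- A family of linearly independent row vectors of the right size is an invertible matrix. -/
theorem exists_inverse_of_linearIndependent {D : Type*} [DivisionRing D] {n : ℕ}
    (X : Matrix (Fin n) (Fin n) D) (h : LinearIndependent D fun k => X k) :
    ∃ Y : Matrix (Fin n) (Fin n) D, X * Y = 1 ∧ Y * X = 1 := by
  have hspan := h.span_eq_top_of_card_eq_finrank' (by simp)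
  have hrow : ∀ k : Fin n, ∃ c : Fin n → D, ∑ l, c l • X l = (1 : Matrix (Fin n) (Fin n) D) k := by
    intro k
    exact (Submodule.mem_span_range_iff_exists_fun D).mp (hspan ▸ Submodule.mem_top)
  choose Y hY using hrow
  have hYX : Matrix.of Y * X = 1 := by
    ext k l
    rw [← hY, Matrix.mul_apply, Finset.sum_apply]
    rfl
  exact ⟨Matrix.of Y, mul_eq_one_comm.mp hYX, hYX⟩

open Matrix in
/-- As many nonzero orthogonal idempotents of `M_{p₁}(D) × ⋯ × M_{pᵣ}(D)` as there are diagonal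
matrix units are simultaneously conjugate to the latter. -/
theorem exists_conj_blockUnit {D : Type*} [DivisionRing D] (f : Idx p → BlockProduct p D)
    (hidem : ∀ a, f a * f a = f a) (horth : ∀ a b, a ≠ b → f a * f b = 0) (hne : ∀ a, f a ≠ 0) :
    ∃ (X : (BlockProduct p D)ˣ) (σ : Equiv.Perm (Idx p)),
      ∀ a, X * f a = blockUnit D (σ a) * X := by
  -- The vector is a nonzero row of some component of `f a`, extended by zero to the other
  -- components; idempotency makes `f a` fix it.
  have hex : ∀ a, ∃ (i : Fin r) (v : ∀ j, Fin (p j) → D), v i ≠ 0 ∧ ∀ j, v j ᵥ* f a j = v j := by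
    intro a
    obtain ⟨i, hi⟩ := Function.ne_iff.mp (hne a)
    obtain ⟨k, hk⟩ := Function.ne_iff.mp hi
    refine ⟨i, Pi.single i (f a i k), by rw [Pi.single_eq_same]; exact hk, fun j => ?_⟩
    by_cases hj : j = i
    · subst hj
      rw [Pi.single_eq_same, ← Matrix.mul_apply_eq_vecMul]
      exact congrFun (congrFun (hidem a) j) k
    · rw [Pi.single_eq_of_ne hj, Matrix.zero_vecMul]
  choose l v hv0 hv using hex
  have hv' : ∀ a b, a ≠ b → ∀ j, v a j ᵥ* f b j = 0 := by
    intro a b hab j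
    rw [← hv a j, Matrix.vecMul_vecMul]
    have : f a j * f b j = 0 := congrFun (horth a b hab) j
    rw [this, Matrix.vecMul_zero]
  have hli : ∀ i, LinearIndependent D fun a : {a // l a = i} => v a.1 i := by
    intro i
    rw [Fintype.linearIndependent_iff]
    rintro g hg ⟨b, rfl⟩
    have h1 := congrArg (Matrix.vecMulLinear (f b (l b))) hg
    rw [map_sum, map_zero, Finset.sum_eq_single ⟨b, rfl⟩] at h1
    · rw [map_smul, Matrix.vecMulLinear_apply, hv, smul_eq_zero] at h1
      exact h1.resolve_right (hv0 b)
    · intro a _ ha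
      rw [map_smul, Matrix.vecMulLinear_apply, hv' _ _ (fun h => ha (Subtype.ext h)), smul_zero]
    · simp
  have hle : ∀ i, Fintype.card {a // l a = i} ≤ p i := fun i => by
    simpa using (hli i).fintype_card_le_finrank
  -- Independence allows at most `p i` vectors in component `i`; there are `∑ i, p i` in all, so
  -- every component receives a full basis. These bases are the rows of `X`.
  have hsum : ∑ i, Fintype.card {a // l a = i} = ∑ i, p i := by
    rw [← Fintype.card_sigma, Fintype.card_congr (Equiv.sigmaFiberEquiv l)]
    simp
  have hcard : ∀ i, Fintype.card {a // l a = i} = p i := fun i =>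
    (Finset.sum_eq_sum_iff_of_le fun i _ => hle i).mp hsum i (Finset.mem_univ i)
  let E : ∀ i, {a // l a = i} ≃ Fin (p i) := fun i => Fintype.equivFinOfCardEq (hcard i)
  let σ : Equiv.Perm (Idx p) :=
    (Equiv.sigmaFiberEquiv l).symm.trans (Equiv.sigmaCongrRight E)
  have hσ : ∀ i k, σ.symm ⟨i, k⟩ = ((E i).symm k).1 := fun i k => rfl
  let X : BlockProduct p D := fun i => Matrix.of fun k => v ((E i).symm k).1 i
  have hX : ∀ i, ∃ Y : Matrix (Fin (p i)) (Fin (p i)) D, X i * Y = 1 ∧ Y * X i = 1 := fun i =>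
    exists_inverse_of_linearIndependent (X i) ((hli i).comp _ (E i).symm.injective)
  choose Y hXY hYX using hX
  refine ⟨⟨X, Y, funext hXY, funext hYX⟩, σ, fun a => ?_⟩
  ext i k m
  change (X i * f a i) k m = (blockUnit D (σ a) i * X i) k m
  rw [blockUnit, Matrix.diagonal_mul, Matrix.mul_apply_eq_vecMul]
  change (v ((E i).symm k).1 i ᵥ* f a i) m = _ * v ((E i).symm k).1 i m
  rw [← hσ]
  by_cases h : σ a = ⟨i, k⟩
  · rw [if_pos h, ← h, σ.symm_apply_apply, hv, one_mul]
  · rw [if_neg h, hv' _ _ (fun h' => h (by rw [← h', σ.apply_symm_apply])), zero_mul]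
    rfl

end Idempotents

/-! ### Moving an automorphism so that it permutes the diagonal matrix units. -/

section Conjugation

variable {R F : Type*} [CommRing R] [DivisionRing F] [Algebra R F] {O : Subalgebra R F}
  {r : ℕ} {p : Fin r → ℕ}

/-- The diagonal matrix units of the standard order. -/
def diagUnit (O : Subalgebra R F) (a : Idx p) : standardOrder O p :=
  ⟨Matrix.single a a 1, single_mem_of_le O.one_mem le_rfl⟩

theorem coe_diagUnit (a : Idx p) :
    (diagUnit O a : Matrix (Idx p) (Idx p) F) = Matrix.single a a 1 := rfl

theorem diagUnit_mul_self (a : Idx p) : diagUnit O a * diagUnit O a = diagUnit O a :=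
  Subtype.ext (by
    rw [MulMemClass.coe_mul, coe_diagUnit, Matrix.single_mul_single_same, mul_one])

theorem diagUnit_mul_of_ne {a b : Idx p} (h : a ≠ b) : diagUnit O a * diagUnit O b = 0 :=
  Subtype.ext (by
    rw [MulMemClass.coe_mul, coe_diagUnit, coe_diagUnit, Matrix.single_mul_single_of_ne _ _ _ _ h]
    rfl)

theorem diagUnit_ne_zero (a : Idx p) : diagUnit O a ≠ 0 := by
  intro h
  have := congrFun (congrFun (congrArg Subtype.val h) a) a
  rw [coe_diagUnit, Matrix.single_apply_same] at this
  exact one_ne_zero this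

theorem sum_diagUnit : ∑ a, diagUnit O (p := p) a = 1 := by
  apply Subtype.ext
  simp only [AddSubmonoidClass.coe_finsetSum, coe_diagUnit]
  ext a b
  rw [Matrix.sum_apply, Finset.sum_eq_single a]
  · by_cases h : a = b <;> simp [h]
  · intro k _ hk
    simp [hk]
  · simp

theorem reduction_diagUnit (a : Idx p) :
    reduction O p (diagUnit O a) = blockUnit (Residue O) a := by
  ext i k l
  rw [reduction_apply, blockUnit, Matrix.diagonal_apply]
  have : entry (diagUnit O a) ⟨i, k⟩ ⟨i, l⟩ = if k = l then if a = ⟨i, k⟩ then 1 else 0 else 0 := by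
    ext
    change (Matrix.single a a (1 : F)) ⟨i, k⟩ ⟨i, l⟩ = _
    rw [Matrix.single_apply]
    by_cases h : k = l
    · subst h
      by_cases h' : a = ⟨i, k⟩ <;> simp [h']
    · rw [if_neg h, if_neg]
      · rfl
      · rintro ⟨rfl, h2⟩
        simp at h2
        exact h h2
  rw [this]
  split_ifs <;> simp

variable [IsLocalRing O]

theorem residue_isUnit_or_eq_zero (z : Residue O) : IsUnit z ∨ z = 0 := by
  obtain ⟨x, rfl⟩ := Ideal.Quotient.mk_surjective z
  by_cases hx : IsUnit x
  · exact Or.inl (hx.map _)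
  · exact Or.inr (Ideal.Quotient.eq_zero_iff_mem.mpr (mem_jacobson_iff_not_isUnit.mpr hx))

theorem exists_conj_blockUnit_residue (f : Idx p → BlockProduct p (Residue O))
    (hidem : ∀ a, f a * f a = f a) (horth : ∀ a b, a ≠ b → f a * f b = 0) (hne : ∀ a, f a ≠ 0) :
    ∃ (X : (BlockProduct p (Residue O))ˣ) (σ : Equiv.Perm (Idx p)),
      ∀ a, X * f a = blockUnit (Residue O) (σ a) * X := by
  have : Nontrivial (Residue O) := Ideal.Quotient.nontrivial_iff.mpr (Ring.jacobson_lt_top O).ne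
  let _ : DivisionRing (Residue O) := DivisionRing.ofIsUnitOrEqZero residue_isUnit_or_eq_zero
  exact exists_conj_blockUnit f hidem horth hne

/-- Up to an inner automorphism, every automorphism of the standard order permutes the diagonal
matrix units. -/
theorem exists_conj_diagUnit (φ : RingAut (standardOrder O p)) :
    ∃ (g : (standardOrder O p)ˣ) (σ : Equiv.Perm (Idx p)),
      ∀ a, (Ad g * φ) (diagUnit O a) = diagUnit O (σ a) := by
  obtain ⟨X, σ, hX⟩ := exists_conj_blockUnit_residue
    (fun a : Idx p => reduction O p (φ (diagUnit O a)))
    (fun a => by simp only [← map_mul, diagUnit_mul_self])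
    (fun a b hab => by simp only [← map_mul, diagUnit_mul_of_ne hab, map_zero])
    (fun a h => by
      have h1 : φ (diagUnit O a) ∈ Ring.jacobson (standardOrder O p) := by
        rw [jacobson_standardOrder]
        exact h
      have h2 := eq_zero_of_mem_jacobson_of_idempotent h1
        (by rw [← map_mul, diagUnit_mul_self])
      exact diagUnit_ne_zero a ((map_eq_zero_iff φ φ.injective).mp h2))
  obtain ⟨u, hu⟩ := exists_unit_lift (residueEquiv O p) X
  rw [residueEquiv_mk] at hu
  set f : Idx p → standardOrder O p := fun a => Ad u (φ (diagUnit O a)) with hf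
  have hff : ∀ a, f a * f a = f a := fun a => by simp only [hf, ← map_mul, diagUnit_mul_self]
  have hfo : ∀ a b, a ≠ b → f a * f b = 0 := fun a b hab => by
    simp only [hf, ← map_mul, diagUnit_mul_of_ne hab, map_zero]
  have hred : ∀ a, reduction O p (f a) = reduction O p (diagUnit O (σ a)) := by
    intro a
    have h1 : f a * u = u * φ (diagUnit O a) := by
      simp only [hf, Ad_apply, Units.inv_mul_cancel_right]
    have h2 := congrArg (reduction O p) h1
    rw [map_mul, map_mul, hu, hX] at h2
    rw [reduction_diagUnit]
    exact X.isUnit.mul_right_cancel h2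
  -- After conjugation by `u` the two families of idempotents agree modulo the radical. This `g` is
  -- 1 modulo the radical, hence a unit, and satisfies `g * f a = diagUnit O (σ a) * g`.
  set g := ∑ a, diagUnit O (σ a) * f a with hg
  have hg1 : reduction O p g = 1 := by
    rw [hg, map_sum]
    simp only [map_mul, hred]
    simp only [← map_mul, diagUnit_mul_self]
    rw [← map_sum, Equiv.sum_comp σ, sum_diagUnit, map_one]
  have hgu : IsUnit g := by
    refine isUnit_of_isUnit_mk_jacobson ?_
    have : Ideal.Quotient.mk (Ring.jacobson (standardOrder O p)) g = 1 := by
      apply (residueEquiv O p).injective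
      rw [residueEquiv_mk, hg1, map_one]
    rw [this]
    exact isUnit_one
  obtain ⟨v, hv⟩ := hgu
  have h1 : ∀ a, g * f a = diagUnit O (σ a) * f a := by
    intro a
    rw [hg, Finset.sum_mul, Finset.sum_eq_single a]
    · rw [mul_assoc, hff]
    · intro b _ hb
      rw [mul_assoc, hfo b a hb, mul_zero]
    · simp
  have h2 : ∀ a, diagUnit O (σ a) * g = diagUnit O (σ a) * f a := by
    intro a
    rw [hg, Finset.mul_sum, Finset.sum_eq_single a]
    · rw [← mul_assoc, diagUnit_mul_self]
    · intro b _ hb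
      rw [← mul_assoc, diagUnit_mul_of_ne (fun h => hb (σ.injective h).symm), zero_mul]
    · simp
  refine ⟨v * u, σ, fun a => ?_⟩
  have h3 : (Ad (v * u) * φ) (diagUnit O a) = v * f a * (↑v⁻¹ : standardOrder O p) := by
    rw [RingAut.mul_apply]
    simp only [hf, Ad_apply, mul_inv_rev, Units.val_mul, mul_assoc]
  rw [h3, hv, h1, ← h2, ← hv, Units.mul_inv_cancel_right]

end Conjugation

/-! ### Monomial form of automorphisms permuting the diagonal matrix units. -/

section Corner

variable {R F : Type*} [CommRing R] [DivisionRing F] [Algebra R F] {O : Subalgebra R F}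
  {r : ℕ} {p : Fin r → ℕ}

/-- The multiple `c E_{aa}` of a diagonal matrix unit. -/
def diagElem (a : Idx p) (c : O) : standardOrder O p :=
  ⟨Matrix.single a a (c : F), single_mem_of_le c.2 le_rfl⟩

theorem coe_diagElem (a : Idx p) (c : O) :
    (diagElem a c : Matrix (Idx p) (Idx p) F) = Matrix.single a a (c : F) := rfl

theorem diagElem_one (a : Idx p) : diagElem a (1 : O) = diagUnit O a := rfl

theorem diagElem_mul (a : Idx p) (c d : O) : diagElem a (c * d) = diagElem a c * diagElem a d :=
  Subtype.ext (Matrix.single_mul_single_same (c : F) a a a (d : F)).symm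

theorem diagElem_add (a : Idx p) (c d : O) : diagElem a (c + d) = diagElem a c + diagElem a d :=
  Subtype.ext (Matrix.single_add a a (c : F) (d : F))

theorem entry_diagElem (a : Idx p) (c : O) : entry (diagElem a c) a a = c :=
  Subtype.ext (Matrix.single_apply_same a a (c : F))

theorem coe_diagUnit_mul_mul_diagUnit (a b : Idx p) (x : standardOrder O p) :
    (diagUnit O a * x * diagUnit O b : standardOrder O p).1 = Matrix.single a b (x.1 a b) := by
  change Matrix.single a a (1 : F) * x.1 * Matrix.single b b (1 : F) = _
  rw [Matrix.single_mul_mul_single, one_mul, mul_one]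

/-- The corner cut out by a diagonal matrix unit is a copy of `O`, and `φ` carries the corner at `a`
to the corner at `b`. -/
theorem map_diagElem_eq (φ : RingAut (standardOrder O p)) {a b : Idx p}
    (h : φ (diagUnit O a) = diagUnit O b) (c : O) :
    φ (diagElem a c) = diagElem b (entry (φ (diagElem a c)) b b) := by
  have h1 : diagElem a c = diagUnit O a * diagElem a c * diagUnit O a := by
    apply Subtype.ext
    rw [coe_diagUnit_mul_mul_diagUnit, coe_diagElem, Matrix.single_apply_same]
  have h2 : φ (diagElem a c) = diagUnit O b * φ (diagElem a c) * diagUnit O b := by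
    conv_lhs => rw [h1, map_mul, map_mul, h]
  apply Subtype.ext
  conv_lhs => rw [h2, coe_diagUnit_mul_mul_diagUnit]
  rfl

/-- The endomorphism of `O` obtained from an automorphism of the standard order that maps one
diagonal matrix unit to another. -/
def cornerHom (φ : RingAut (standardOrder O p)) {a b : Idx p}
    (h : φ (diagUnit O a) = diagUnit O b) : O →+* O where
  toFun c := entry (φ (diagElem a c)) b b
  map_one' := by rw [diagElem_one, h, ← diagElem_one, entry_diagElem]
  map_zero' := by
    have : diagElem a (0 : O) = 0 := Subtype.ext (Matrix.single_zero a a)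
    rw [this, map_zero]
    rfl
  map_add' c d := by
    rw [diagElem_add, map_add]
    rfl
  map_mul' c d := by
    rw [diagElem_mul, map_mul, map_diagElem_eq φ h c, map_diagElem_eq φ h d, ← diagElem_mul,
      entry_diagElem, entry_diagElem, entry_diagElem]

theorem map_diagElem (φ : RingAut (standardOrder O p)) {a b : Idx p}
    (h : φ (diagUnit O a) = diagUnit O b) (c : O) :
    φ (diagElem a c) = diagElem b (cornerHom φ h c) :=
  map_diagElem_eq φ h c

theorem inv_apply_diagUnit (φ : RingAut (standardOrder O p)) {a b : Idx p}
    (h : φ (diagUnit O a) = diagUnit O b) : φ⁻¹ (diagUnit O b) = diagUnit O a := by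
  rw [← h]
  exact φ.symm_apply_apply _

theorem cornerHom_inv (φ : RingAut (standardOrder O p)) {a b : Idx p}
    (h : φ (diagUnit O a) = diagUnit O b) (c : O) :
    cornerHom φ⁻¹ (inv_apply_diagUnit φ h) (cornerHom φ h c) = c := by
  change entry (φ⁻¹ (diagElem b (cornerHom φ h c))) a a = c
  rw [← map_diagElem]
  change entry (φ.symm (φ (diagElem a c))) a a = c
  rw [RingEquiv.symm_apply_apply, entry_diagElem]

/-- The automorphism of `O` obtained from an automorphism of the standard order that maps one
diagonal matrix unit to another. -/
def cornerAut (φ : RingAut (standardOrder O p)) {a b : Idx p}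
    (h : φ (diagUnit O a) = diagUnit O b) : RingAut O :=
  RingEquiv.ofRingHom (cornerHom φ h) (cornerHom φ⁻¹ (inv_apply_diagUnit φ h))
    (RingHom.ext fun c => cornerHom_inv φ⁻¹ (inv_apply_diagUnit φ h) c)
    (RingHom.ext fun c => cornerHom_inv φ h c)

theorem cornerAut_apply (φ : RingAut (standardOrder O p)) {a b : Idx p}
    (h : φ (diagUnit O a) = diagUnit O b) (c : O) : cornerAut φ h c = cornerHom φ h c := rfl

variable {w : O} {ω : Fˣ}

/-- An automorphism of the standard order that permutes the diagonal matrix units is, over the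
ambient skew field, an entrywise automorphism followed by conjugation with a monomial matrix. -/
theorem exists_monomial_form (hw : IsUniformizer w) (hω : (ω : F) = w)
    (φ : RingAut (standardOrder O p)) (σ : Equiv.Perm (Idx p))
    (hφ : ∀ a, φ (diagUnit O a) = diagUnit O (σ a)) (a₀ : Idx p) (h₀ : ∀ a : Idx p, a₀.1 ≤ a.1) :
    ∃ (ψ : RingAut O) (v : Idx p → Oˣ), ∀ (x : standardOrder O p) (a b : Idx p),
      (φ x).1 (σ a) (σ b) * (((v b : O) : F) * ((ω ^ blockExp (σ b) (σ a₀) : Fˣ) : F)) =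
        ((v a : O) : F) * ((ω ^ blockExp (σ a) (σ a₀) : Fˣ) : F) * (ψ (entry x a b) : F) := by
  have hN := hw.normalizes hω
  -- As `a₀` lies in a first block, the whole column of matrix units ending in `a₀` belongs to `H`.
  -- Their images supply the entries `u a` of the monomial matrix.
  let col : Idx p → standardOrder O p := fun a =>
    ⟨Matrix.single a a₀ 1, single_mem_of_le O.one_mem (h₀ a)⟩
  let u : Idx p → F := fun a => (φ (col a)).1 (σ a) (σ a₀)
  have hcol : ∀ a, (φ (col a)).1 = Matrix.single (σ a) (σ a₀) (u a) := by
    intro a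
    have h1 : col a = diagUnit O a * col a * diagUnit O a₀ := by
      apply Subtype.ext
      rw [coe_diagUnit_mul_mul_diagUnit]
      simp [col]
    conv_lhs => rw [h1, map_mul, map_mul, hφ, hφ, coe_diagUnit_mul_mul_diagUnit]
  have hu : ∀ a, u a * ((ω ^ (-blockExp (σ a) (σ a₀)) : Fˣ) : F) ∈ O := by
    intro a
    rw [← inPow_iff_right hN]
    exact (mem_standardOrder_iff hw hω).mp (φ (col a)).2 _ _
  -- The power of `ω` at the block exponent lies in the image of the multiples of `col a`, so `u a`
  -- divides it on the right; hence `u a` is a unit times exactly that power.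
  have hunit : ∀ a, IsUnit (⟨_, hu a⟩ : O) := by
    intro a
    have hmem : Matrix.single (σ a) (σ a₀) ((ω ^ blockExp (σ a) (σ a₀) : Fˣ) : F) ∈
        standardOrder O p := by
      rw [mem_standardOrder_iff hw hω]
      intro b c
      rw [Matrix.single_apply]
      split_ifs with h
      · rw [← h.1, ← h.2, hw.inPow_zpow hω]
      · exact inPow_zero_right _
    obtain ⟨y, hy⟩ := φ.surjective ⟨_, hmem⟩
    have h1 : y = diagElem a (entry y a a₀) * col a := by
      have h2 : y = diagUnit O a * y * diagUnit O a₀ := by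
        apply φ.injective
        rw [map_mul, map_mul, hφ, hφ, hy]
        apply Subtype.ext
        rw [coe_diagUnit_mul_mul_diagUnit]
        simp
      apply Subtype.ext
      conv_lhs => rw [h2, coe_diagUnit_mul_mul_diagUnit]
      change _ = Matrix.single a a (y.1 a a₀) * Matrix.single a a₀ 1
      rw [Matrix.single_mul_single_same, mul_one]
    have h2 : Matrix.single (σ a) (σ a₀) ((ω ^ blockExp (σ a) (σ a₀) : Fˣ) : F) =
        Matrix.single (σ a) (σ a) (cornerHom φ (hφ a) (entry y a a₀) : F) *
          Matrix.single (σ a) (σ a₀) (u a) := by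
      rw [← hcol, ← coe_diagElem, ← map_diagElem, ← MulMemClass.coe_mul, ← map_mul, ← h1, hy]
    rw [Matrix.single_mul_single_same] at h2
    have h3 := congrFun (congrFun h2 (σ a)) (σ a₀)
    rw [Matrix.single_apply_same, Matrix.single_apply_same] at h3
    refine IsUnit.of_mul_eq_one_right (cornerHom φ (hφ a) (entry y a a₀)) ?_
    ext
    change _ * (u a * _) = (1 : F)
    rw [← mul_assoc, ← h3, ← Units.val_mul, ← zpow_add, add_neg_cancel, zpow_zero, Units.val_one]
  choose v hv using hunit
  have hvu : ∀ a, ((v a : O) : F) * ((ω ^ blockExp (σ a) (σ a₀) : Fˣ) : F) = u a := by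
    intro a
    rw [hv]
    change u a * _ * _ = u a
    rw [mul_assoc, ← Units.val_mul, ← zpow_add, neg_add_cancel, zpow_zero, Units.val_one, mul_one]
  refine ⟨cornerAut φ (hφ a₀), v, fun x a b => ?_⟩
  rw [hvu, hvu, cornerAut_apply]
  -- Applying `φ` to this relation expresses every entry of `φ x` through the corner automorphism at
  -- `a₀`.
  have h1 : diagUnit O a * x * col b = col a * diagElem a₀ (entry x a b) := by
    apply Subtype.ext
    change Matrix.single a a (1 : F) * x.1 * Matrix.single b a₀ (1 : F) =
      Matrix.single a a₀ (1 : F) * Matrix.single a₀ a₀ (x.1 a b)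
    rw [Matrix.single_mul_mul_single, Matrix.single_mul_single_same, one_mul, mul_one]
  have h2 := congrArg φ h1
  rw [map_mul, map_mul, map_mul, hφ, map_diagElem φ (hφ a₀)] at h2
  have h3 := congrArg Subtype.val h2
  simp only [MulMemClass.coe_mul, hcol, coe_diagElem, coe_diagUnit] at h3
  rw [Matrix.single_mul_mul_single, Matrix.single_mul_single_same, one_mul] at h3
  have h4 := congrFun (congrFun h3 (σ a)) (σ a₀)
  rwa [Matrix.single_apply_same, Matrix.single_apply_same] at h4

/-- The matrix unit at `(b, a)` lies in `H`. The monomial form gives the exact level of the nonzero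
entry of its image, and membership in `H` bounds that level below by the block exponent. -/
theorem blockExp_add_le (hw : IsUniformizer w) (hω : (ω : F) = w)
    (φ : RingAut (standardOrder O p)) (σ : Equiv.Perm (Idx p))
    (hφ : ∀ a, φ (diagUnit O a) = diagUnit O (σ a)) (a₀ : Idx p) (h₀ : ∀ a : Idx p, a₀.1 ≤ a.1)
    (a b : Idx p) (hab : a.1 ≤ b.1) :
    blockExp (σ b) (σ a) + blockExp (σ a) (σ a₀) ≤ blockExp (σ b) (σ a₀) := by
  have hN := hw.normalizes hω
  obtain ⟨ψ, v, h⟩ := exists_monomial_form hw hω φ σ hφ a₀ h₀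
  let x : standardOrder O p := ⟨Matrix.single b a 1, single_mem_of_le O.one_mem hab⟩
  have hx : entry x b a = 1 := Subtype.ext (Matrix.single_apply_same b a (1 : F))
  have h1 := h x b a
  rw [hx, map_one, OneMemClass.coe_one, mul_one, ← mul_assoc] at h1
  have h2 : InPow O ω (blockExp (σ b) (σ a)) ((φ x).1 (σ b) (σ a) * ((v a : O) : F)) :=
    inPow_mul_right ((mem_standardOrder_iff hw hω).mp (φ x).2 _ _) (v a : O).2
  rw [← inPow_conj hN (m := 0) (n := -blockExp (σ a) (σ a₀)), zpow_zero, Units.val_one, one_mul,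
    neg_neg, h1] at h2
  have h3 := inPow_mul_left hN (↑(v b)⁻¹ : O).2 h2
  have h4 : ((↑(v b)⁻¹ : O) : F) * ((v b : O) : F) = 1 := congrArg Subtype.val (v b).inv_mul
  rw [← mul_assoc, h4, one_mul, hw.inPow_zpow hω] at h3
  omega

end Corner

/-! ### Cyclic rotations of the blocks and the minimal period. -/

section Combinatorics

variable {r : ℕ} {p : Fin r → ℕ}

theorem StrictMono.fin_add_le {f : Fin r → ℕ} (hf : StrictMono f) (d i : ℕ) (h : i + d < r) :
    f ⟨i, by omega⟩ + d ≤ f ⟨i + d, h⟩ := by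
  induction d with
  | zero => simp
  | succ d ih =>
    have h1 := ih (by omega)
    have h2 : f ⟨i + d, by omega⟩ < f ⟨i + (d + 1), h⟩ := hf (by simp [Fin.lt_def])
    omega

/-- A permutation of the indices that is compatible with the block exponents up to a coboundary
is a cyclic shift on the blocks. -/
theorem exists_cyclic_shift (hp : ∀ i, 0 < p i) (σ : Equiv.Perm (Idx p)) (a₀ : Idx p)
    (h₀ : (a₀.1 : ℕ) = 0)
    (h : ∀ a b : Idx p, a.1 ≤ b.1 →
      blockExp (σ b) (σ a) + blockExp (σ a) (σ a₀) ≤ blockExp (σ b) (σ a₀)) :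
    ∃ s : ℕ, ∀ a, ((σ a).1 : ℕ) = (a.1 + s) % r := by
  have hr : 0 < r := a₀.1.pos
  -- `N` unrolls the cyclic order of the blocks from the block of `σ a₀`: earlier blocks are raised
  -- by `r`. The hypothesis says precisely that `N` is monotone in the block of `a`.
  let N : Idx p → ℕ := fun a => (σ a).1 + if (σ a).1 < (σ a₀).1 then r else 0
  have hN : ∀ a, N a = (σ a).1 + if (σ a).1 < (σ a₀).1 then r else 0 := fun _ => rfl
  have hmono : ∀ a b : Idx p, a.1 ≤ b.1 → N a ≤ N b := by
    intro a b hab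
    have h1 := h a b hab
    have h2 := (σ a).1.2
    simp only [hN]
    simp only [blockExp, Fin.lt_def] at h1 ⊢
    split_ifs at h1 ⊢ <;> omega
  have hinj : ∀ a b : Idx p, N a = N b → (σ a).1 = (σ b).1 := by
    intro a b hab
    have h1 := (σ a).1.2
    have h2 := (σ b).1.2
    simp only [hN, Fin.lt_def] at hab
    ext
    split_ifs at hab <;> omega
  have hblock : ∀ a b : Idx p, a.1 = b.1 → N a = N b := fun a b hab =>
    le_antisymm (hmono a b hab.le) (hmono b a hab.ge)
  let c : Fin r → Idx p := fun i => ⟨i, ⟨0, hp i⟩⟩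
  have hsurj : Function.Surjective fun i => (σ (c i)).1 := by
    intro j
    refine ⟨(σ.symm (c j)).1, ?_⟩
    have h1 := hinj _ _ (hblock (c (σ.symm (c j)).1) (σ.symm (c j)) rfl)
    rw [σ.apply_symm_apply] at h1
    exact h1
  have hbij := Finite.injective_iff_surjective.mpr hsurj
  have hstrict : StrictMono fun i => N (c i) := by
    refine Monotone.strictMono_of_injective (fun i j hij => hmono _ _ hij) fun i j hij => ?_
    exact hbij (hinj _ _ hij)
  refine ⟨(σ a₀).1, fun a => ?_⟩
  -- On the `r` blocks `N` increases strictly, starts at `(σ a₀).1` and stays below `(σ a₀).1 + r`;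
  -- this leaves only steps of size 1.
  have h1 := StrictMono.fin_add_le hstrict a.1 0 (by omega)
  have h2 := StrictMono.fin_add_le hstrict (r - 1 - a.1) a.1 (by omega)
  have h3 : N (c ⟨0, by omega⟩) = (σ a₀).1 := by
    rw [hblock _ a₀ (Fin.ext h₀.symm), hN, if_neg (lt_irrefl _), add_zero]
  have h4 : N (c ⟨0 + a.1, by omega⟩) = N a := hblock _ _ (Fin.ext (by simp [c]))
  have h5 : N (c ⟨a.1, by omega⟩) = N a := hblock _ _ rfl
  have h6 : ∀ b, N b < (σ a₀).1 + r := by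
    intro b
    have := (σ b).1.2
    simp only [hN, Fin.lt_def]
    split_ifs <;> omega
  have h7 := h6 (c ⟨a.1 + (r - 1 - a.1), by omega⟩)
  simp only [h3, h4, h5] at h1 h2
  have h8 : N a = a.1 + (σ a₀).1 := by omega
  have h9 := (σ a).1.2
  rw [hN] at h8
  rw [← h8]
  split_ifs <;> simp [Nat.mod_eq_of_lt h9]

theorem size_eq_of_perm (σ : Equiv.Perm (Idx p)) {i j : Fin r}
    (h : ∀ a : Idx p, a.1 = i ↔ (σ a).1 = j) : p i = p j := by
  have h1 := Fintype.card_congr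
    (σ.subtypeEquiv h : {a : Idx p // a.1 = i} ≃ {a : Idx p // a.1 = j})
  have h2 : ∀ k : Fin r, Fintype.card {a : Idx p // a.1 = k} = p k := fun k => by
    rw [Fintype.card_congr (Equiv.sigmaSubtype k), Fintype.card_fin]
  rwa [h2, h2] at h1

/-- A cyclic shift that preserves the block sizes is a multiple of the minimal period. -/
theorem IsMinimalPeriod.dvd_shift {t s : ℕ} (ht : IsMinimalPeriod p t) (hr : 0 < r)
    (h : ∀ i j : Fin r, (j : ℕ) = (i + s) % r → p i = p j) : t ∣ s := by
  obtain ⟨⟨ht1, htr, htp⟩, hmin⟩ := ht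
  have hr' : (r : ℤ) ≠ 0 := by omega
  -- Extended to an `r`-periodic function on `ℤ`, the size vector has periods `s` and `t`, hence by
  -- Bézout also their gcd, which minimality forces to be `t`.
  let P : ℤ → ℕ := fun n => p ⟨(n % r).toNat, by
    have := Int.emod_lt_of_pos n (show (0 : ℤ) < r by omega)
    omega⟩
  have hPs : Function.Periodic P (s : ℤ) := by
    intro n
    refine (h _ _ ?_).symm
    zify
    rw [Int.toNat_of_nonneg (Int.emod_nonneg _ hr'), Int.toNat_of_nonneg (Int.emod_nonneg _ hr'),
      Int.emod_add_emod]
  have hPt : Function.Periodic P (t : ℤ) := by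
    intro n
    refine htp _ _ ?_
    zify
    rw [Int.toNat_of_nonneg (Int.emod_nonneg _ hr'), Int.toNat_of_nonneg (Int.emod_nonneg _ hr'),
      Int.emod_emod_of_dvd _ (by exact_mod_cast htr), Int.emod_emod_of_dvd _ (by exact_mod_cast htr),
      Int.add_emod_right]
  have hPg : Function.Periodic P ((Nat.gcd t s : ℕ) : ℤ) := by
    rw [Nat.gcd_eq_gcd_ab, mul_comm, mul_comm (s : ℤ)]
    exact (hPt.int_mul _).add_period (hPs.int_mul _)
  have hP : ∀ i : Fin r, P i = p i := by
    intro i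
    refine congrArg p (Fin.ext ?_)
    simp [Nat.mod_eq_of_lt i.2, ← Int.natCast_mod]
  have hrep : IsRepetition p (Nat.gcd t s) := by
    refine ⟨Nat.gcd_pos_of_pos_left _ ht1, (Nat.gcd_dvd_left t s).trans htr, fun i j hij => ?_⟩
    rw [← hP, ← hP]
    obtain ⟨k, hk⟩ : ((Nat.gcd t s : ℕ) : ℤ) ∣ (i : ℤ) - j :=
      (Nat.modEq_iff_dvd.mp (show (j : ℕ) ≡ i [MOD Nat.gcd t s] from hij.symm))
    have : (i : ℤ) = j + k * (Nat.gcd t s : ℕ) := by linarith [mul_comm k ((Nat.gcd t s : ℕ) : ℤ)]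
    rw [this]
    exact hPg.int_mul k j
  have hle : t ≤ Nat.gcd t s := hmin hrep
  have : Nat.gcd t s = t := le_antisymm (Nat.gcd_le_left _ ht1) hle
  exact this ▸ Nat.gcd_dvd_right t s

end Combinatorics

/-! ### Generators of the automorphism group. -/

section Generation

variable {R F : Type*} [CommRing R] [DivisionRing F] [Algebra R F] {O : Subalgebra R F}
  {r : ℕ} {p : Fin r → ℕ} {w : O} {ω : Fˣ}

/-- A monomial matrix over the units of `O` that preserves the blocks is a unit of the standard
order. -/
def monomialStandardUnit (τ : Equiv.Perm (Idx p)) (hτ : ∀ a, (τ a).1 = a.1) (c : Idx p → Oˣ) :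
    (standardOrder O p)ˣ where
  val := ⟨monomialUnit τ fun a => (c a).map (O.val : O →* F), fun a b => by
    rw [monomialUnit_apply]
    split_ifs with h
    · exact ⟨(c a : O).2, fun h' => absurd h' (by rw [← h, hτ]; exact lt_irrefl _)⟩
    · exact ⟨O.zero_mem, fun _ => radSet_zero⟩⟩
  inv := ⟨(monomialUnit τ fun a => (c a).map (O.val : O →* F))⁻¹.val, fun a b => by
    rw [monomialUnit_inv_apply]
    split_ifs with h
    · exact ⟨(↑(c b)⁻¹ : O).2, fun h' => absurd h' (by rw [h, hτ]; exact lt_irrefl _)⟩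
    · exact ⟨O.zero_mem, fun _ => radSet_zero⟩⟩
  val_inv := Subtype.ext (Units.mul_inv _)
  inv_val := Subtype.ext (Units.inv_mul _)

theorem Ad_monomialStandardUnit_apply (τ : Equiv.Perm (Idx p)) (hτ : ∀ a, (τ a).1 = a.1)
    (c : Idx p → Oˣ) (x : standardOrder O p) (a b : Idx p) :
    (Ad (monomialStandardUnit τ hτ c) x).1 a b =
      ((c a : O) : F) * x.1 (τ a) (τ b) * ((↑(c b)⁻¹ : O) : F) :=
  monomialUnit_conj_apply τ _ x.1 a b

/-- An automorphism of the standard order that permutes the diagonal matrix units within the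
blocks is a product of an inner and an entrywise automorphism. -/
theorem exists_eq_Ad_mul_inducedAut (hw : IsUniformizer w) (hω : (ω : F) = w)
    (φ : RingAut (standardOrder O p)) (σ : Equiv.Perm (Idx p))
    (hφ : ∀ a, φ (diagUnit O a) = diagUnit O (σ a)) (a₀ : Idx p) (h₀ : ∀ a : Idx p, a₀.1 ≤ a.1)
    (hσ : ∀ a, (σ a).1 = a.1) :
    ∃ (g : (standardOrder O p)ˣ) (ψ : RingAut O), φ = Ad g * inducedAut p ψ := by
  obtain ⟨ψ, v, h⟩ := exists_monomial_form hw hω φ σ hφ a₀ h₀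
  -- No image block precedes that of `σ a₀`, so no powers of `ω` occur and the monomial matrix has
  -- entries in the units of `O`.
  have hexp : ∀ a, blockExp (σ a) (σ a₀) = 0 := by
    intro a
    rw [blockExp, if_neg]
    rw [hσ, hσ]
    exact not_lt.mpr (h₀ a)
  have hσ' : ∀ a, (σ.symm a).1 = a.1 := fun a => by rw [← hσ, σ.apply_symm_apply]
  refine ⟨monomialStandardUnit σ.symm hσ' fun a => v (σ.symm a), ψ, ?_⟩
  ext x a b
  rw [RingAut.mul_apply, Ad_monomialStandardUnit_apply]
  have h1 := h x (σ.symm a) (σ.symm b)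
  rw [hexp, hexp, zpow_zero, Units.val_one, mul_one, mul_one, σ.apply_symm_apply,
    σ.apply_symm_apply] at h1
  change _ = _ * (ψ (entry x (σ.symm a) (σ.symm b)) : F) * _
  rw [← h1, mul_assoc]
  have h2 : ((v (σ.symm b) : O) : F) * ((↑(v (σ.symm b))⁻¹ : O) : F) = 1 :=
    congrArg Subtype.val (v (σ.symm b)).mul_inv
  rw [h2, mul_one]

variable {t : ℕ} (ht : IsMinimalPeriod p t)

theorem conjAut_rotationUnit_diagUnit
    (hϱ : Normalizes (rotationUnit ht ω) (standardOrder O p)) (a : Idx p) :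
    conjAut (rotationUnit ht ω) (standardOrder O p) hϱ (diagUnit O (shiftPerm ht a)) =
      diagUnit O a := by
  ext b c
  refine (rotationUnit_conj_apply ht ω _ b c).trans ?_
  rw [coe_diagUnit, coe_diagUnit, Matrix.single_apply, Matrix.single_apply]
  simp only [(shiftPerm ht).injective.eq_iff]
  split_ifs with h
  · rw [← h.1, ← h.2, mul_one, Units.mul_inv]
  · simp

theorem shiftPerm_fst_of_eq {n : ℕ} {a : Idx p} (h : (a.1 : ℕ) = (n + t) % r) :
    ((shiftPerm ht a).1 : ℕ) = n % r := by
  have hr := a.1.pos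
  have hle := ht.le hr
  rw [shiftPerm_apply, shiftSource_val]
  have h1 := Nat.mod_lt n hr
  rw [← Nat.mod_add_mod] at h
  rcases lt_or_ge (n % r + t) r with h2 | h2
  · rw [Nat.mod_eq_of_lt h2] at h
    split_ifs <;> omega
  · rw [Nat.mod_eq_sub_mod h2, Nat.mod_eq_of_lt (by omega)] at h
    split_ifs <;> omega

/-- Each factor of the inverse of the conjugation with `ϱ` lowers the rotation by `t` blocks, until
the blocks are fixed. -/
theorem mem_closure_of_shift (hw : IsUniformizer w) (hω : (ω : F) = w)
    (hϱ : Normalizes (rotationUnit ht ω) (standardOrder O p))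
    (a₀ : Idx p) (h₀ : ∀ a : Idx p, a₀.1 ≤ a.1) (k : ℕ) :
    ∀ (φ : RingAut (standardOrder O p)) (σ : Equiv.Perm (Idx p)),
      (∀ a, φ (diagUnit O a) = diagUnit O (σ a)) →
      (∀ a, ((σ a).1 : ℕ) = (a.1 + t * k) % r) →
      φ ∈ Subgroup.closure (Set.range (Ad (Γ := standardOrder O p)) ∪
        Set.range (inducedAut (O := O) p) ∪
          {conjAut (rotationUnit ht ω) (standardOrder O p) hϱ}) := by
  induction k with
  | zero =>
    intro φ σ hφ hσ
    obtain ⟨g, ψ, rfl⟩ := exists_eq_Ad_mul_inducedAut hw hω φ σ hφ a₀ h₀ fun a => by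
      ext
      rw [hσ, mul_zero, add_zero, Nat.mod_eq_of_lt a.1.2]
    exact Subgroup.mul_mem _ (Subgroup.subset_closure (Or.inl (Or.inl ⟨g, rfl⟩)))
      (Subgroup.subset_closure (Or.inl (Or.inr ⟨ψ, rfl⟩)))
  | succ k ih =>
    intro φ σ hφ hσ
    set ρ := conjAut (rotationUnit ht ω) (standardOrder O p) hϱ
    have h1 : φ = ρ * (ρ⁻¹ * φ) := by rw [mul_inv_cancel_left]
    rw [h1]
    refine Subgroup.mul_mem _ (Subgroup.subset_closure (Or.inr rfl))
      (ih (ρ⁻¹ * φ) (shiftPerm ht * σ) (fun a => ?_) fun a => ?_)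
    · rw [RingAut.mul_apply, hφ, Equiv.Perm.mul_apply]
      have h2 := conjAut_rotationUnit_diagUnit (O := O) ht hϱ (σ a)
      rw [← h2]
      exact ρ.symm_apply_apply _
    · rw [Equiv.Perm.mul_apply]
      refine shiftPerm_fst_of_eq ht ?_
      rw [hσ, mul_add, mul_one, add_assoc]

/-- The automorphism group of the standard order is generated by the inner automorphisms, the
entrywise automorphisms and the conjugation with the rotation matrix. -/
theorem closure_generators [IsLocalRing O] (hw : IsUniformizer w) (hω : (ω : F) = w)
    (hr : 0 < r) (hp : ∀ i, 0 < p i)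
    (hϱ : Normalizes (rotationUnit ht ω) (standardOrder O p)) :
    Subgroup.closure (Set.range (Ad (Γ := standardOrder O p)) ∪
      Set.range (inducedAut (O := O) p) ∪
        {conjAut (rotationUnit ht ω) (standardOrder O p) hϱ}) = ⊤ := by
  rw [eq_top_iff]
  rintro φ -
  let a₀ : Idx p := ⟨⟨0, hr⟩, ⟨0, hp _⟩⟩
  have h₀ : ∀ a : Idx p, a₀.1 ≤ a.1 := fun a => Fin.le_def.mpr (Nat.zero_le _)
  obtain ⟨g, σ, hσ⟩ := exists_conj_diagUnit φ
  obtain ⟨s, hs⟩ := exists_cyclic_shift hp σ a₀ rfl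
    (blockExp_add_le hw hω (Ad g * φ) σ hσ a₀ h₀)
  have hdvd : t ∣ s := by
    -- `σ` maps block `i` bijectively onto block `i + s` modulo `r`, so these have equal sizes.
    refine ht.dvd_shift hr fun i j hij => size_eq_of_perm σ fun a => ?_
    rw [Fin.ext_iff, Fin.ext_iff, hs, hij]
    refine ⟨fun h => by rw [h], fun h => ?_⟩
    exact Nat.ModEq.eq_of_lt_of_lt (Nat.ModEq.add_right_cancel' s h) a.1.2 i.2
  obtain ⟨k, rfl⟩ := hdvd
  have h1 := mem_closure_of_shift ht hw hω hϱ a₀ h₀ k (Ad g * φ) σ hσ hs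
  rw [← inv_mul_cancel_left (Ad g) φ]
  exact Subgroup.mul_mem _
    (Subgroup.inv_mem _ (Subgroup.subset_closure (Or.inl (Or.inl ⟨g, rfl⟩)))) h1

end Generation

end HereditaryOrder

/-! ### Assembly of the theorem. -/

theorem corollaryC
    {R K F : Type*} [CommRing R] [IsDomain R] [IsDiscreteValuationRing R]
    [IsAdicComplete (IsLocalRing.maximalIdeal R) R]
    [Field K] [Algebra R K] [IsFractionRing R K]
    [DivisionRing F] [Algebra K F] [Algebra R F] [IsScalarTower R K F] [FiniteDimensional K F]
    (O : Subalgebra R F) (hO : IsMaximalOrder R K O)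
    (w : O) (hw : IsUniformizer w)
    {r : ℕ} (hr : 0 < r) (p : Fin r → ℕ) (hp : ∀ i, 0 < p i)
    (t : ℕ) (ht : IsMinimalPeriod p t) :
    -- `w` is invertible in `F` and `Ad_w` is an automorphism of `O`
    ∃ (ω : Fˣ) (_ : (ω : F) = w) (hω : Normalizes ω O)
      -- the rotation matrix is invertible over `F` and `Ad_ϱ` is an automorphism of `H(O, p)`
      (ϱ : (Matrix (Idx p) (Idx p) F)ˣ) (_ : (ϱ : Matrix (Idx p) (Idx p) F) = rotation p t (w : F))
      (hϱ : Normalizes ϱ (standardOrder O p))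
      -- `H / rad H ≅ M_{p₁}(O / rad O) × ⋯ × M_{pᵣ}(O / rad O)` by reducing the diagonal blocks
      (e : Residue (standardOrder O p) ≃+* BlockProduct p (Residue O)),
      (∀ (x : standardOrder O p) (i : Fin r) (a b : Fin (p i)),
        e (Ideal.Quotient.mk _ x) i a b = Ideal.Quotient.mk _ (entry x ⟨i, a⟩ ⟨i, b⟩)) ∧
      -- generation of the automorphism group
      Subgroup.closure (Set.range (Ad (Γ := standardOrder O p)) ∪
        Set.range (inducedAut (O := O) p) ∪ {conjAut ϱ (standardOrder O p) hϱ}) = ⊤ ∧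
      -- (a) inner automorphisms induce precisely the inner automorphisms
      inducedOn e '' Set.range (Ad (Γ := standardOrder O p)) =
        Set.range (Ad (Γ := BlockProduct p (Residue O))) ∧
      -- (b) automorphisms of `O` induce the entrywise actions of their residue automorphisms
      (∀ ψ : RingAut O,
        inducedOn e (inducedAut p ψ) = entrywiseAut p (residueAut O ψ)) ∧
      inducedOn e '' Set.range (inducedAut (O := O) p) =
        entrywiseAut p '' ((residueAut O).range : Set (RingAut (Residue O))) ∧
      -- (c) `Ad_ϱ` induces the cyclic shift twisted by the automorphism induced by `Ad_w`
      (∀ z, inducedOn e (conjAut ϱ (standardOrder O p) hϱ) z =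
        twistedShift ht (residueAut O (conjAut ω O hω)) z) ∧
      -- another uniformizer gives the same twisted shift up to an inner automorphism
      (∀ w' : O, IsUniformizer w' → (∃ u : Oˣ, w' = u * w) ∧
        ∃ (ω' : Fˣ) (_ : (ω' : F) = w') (hω' : Normalizes ω' O)
          (g : (BlockProduct p (Residue O))ˣ),
          ∀ z, twistedShift ht (residueAut O (conjAut ω' O hω')) z =
            Ad g (twistedShift ht (residueAut O (conjAut ω O hω)) z)) := by
  have hloc : IsLocalRing O := hO.prop.isLocalRing
  have h0 : (w : F) ≠ 0 := hw.ne_zero hO.prop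
  let ω : Fˣ := Units.mk0 w h0
  have hω : (ω : F) = w := rfl
  have hN : Normalizes ω O := hw.normalizes hω
  have hϱ : Normalizes (rotationUnit ht ω) (standardOrder O p) := rotationUnit_normalizes ht hw hω
  exact ⟨ω, hω, hN, rotationUnit ht ω, coe_rotationUnit ht ω, hϱ, residueEquiv O p,
    fun _ _ _ _ => rfl, closure_generators ht hw hω hr hp hϱ,
    inducedOn_image_range_Ad (residueEquiv O p), inducedOn_inducedAut,
    inducedOn_image_range_inducedAut, inducedOn_conjAut_rotationUnit ht hN hϱ,
    fun _ hw' => hw.exists_twistedShift_eq ht hω hN hw'⟩
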